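/- Let $\mathcal T=\mathbb R/2\pi\mathbb Z$. For a Borel probability measure $\mu$ on $\mathcal T$ write $R_\mu e^{i\varphi_\mu}=\int_{\mathcal T}e^{i\vartheta}\,d\mu(\vartheta)$ with $R_\mu\ge 0$, and $v_\mu(\vartheta)=-\int_{\mathcal T}\sin(\vartheta-\vartheta')\,d\mu(\vartheta')=-R_\mu\sin(\vartheta-\varphi_\mu)$. A family $(\rho_t)_{t\ge 0}$ of Borel probability measures on $\mathcal T$ is a measure-valued solution of the kinetic Kuramoto equation for identical oscillators (natural frequency $0$, coupling constant $1$), $$\partial_t\rho_t+\partial_\vartheta(v_{\rho_t}\rho_t)=0,$$ if there is a flow of characteristics $\Theta:[0,\infty)\times\mathcal T\to\mathcal T$ with $\dot\Theta(t,\vartheta)=v_{\rho_t}(\Theta(t,\vartheta))$ for all $t\ge 0$, $\Theta(0,\vartheta)=\vartheta$, and $$\int_{\mathcal T}h(\vartheta)\,d\rho_t(\vartheta)=\int_{\mathcal T}h(\Theta(t,\vartheta))\,d\rho_0(\vartheta)$$ for all $t\ge 0$ and all continuous $h:\mathcal T\to\mathbb R$. A solution is stationary if $\rho_t=\rho_0$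 for all $t\ge 0$. **Theorem.** Let $(\rho_t)_{t\ge 0}$ be a measure-valued solution that is not stationary. Then there are $\varphi^*\in\mathcal T$ and real numbers $c_1>c_2\ge 0$ with $c_1+c_2=1$ such that $$\rho^*=c_1\delta_{\varphi^*}+c_2\delta_{\varphi^*+\pi}$$ is a stationary solution and $\rho_t\to\rho^*$ weak-* as $t\to\infty$. Moreover, if $\rho_0$ is non-atomic, i.e. $\rho_0(\{\vartheta\})=0$ for every $\vartheta\in\mathcal T$, then $\rho^*=\delta_{\varphi^*}$ (complete phase synchronization). -/

import Mathlib

open MeasureTheory Filter Topology Set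

noncomputable section

namespace Kuramoto

/-- The one-dimensional torus of phases, `ℝ / 2πℤ`, with its quotient topology. -/
abbrev Phase : Type := Real.Angle

/-- The torus carries its Borel σ-algebra. -/
instance instMeasurableSpacePhase : MeasurableSpace Phase := borel Phase

instance instBorelSpacePhase : BorelSpace Phase := ⟨rfl⟩

/-- The centre of mass `∫ e^{iϑ} dμ(ϑ)` of a distribution of phases. -/
def centerOfMass (μ : ProbabilityMeasure Phase) : ℂ :=
  ∫ θ : Phase, (Real.Angle.toCircle θ : ℂ) ∂(μ : Measure Phase)

/-- The order parameter `R ≥ 0`, where `R e^{iφ} = ∫ e^{iϑ} dμ(ϑ)`. -/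
def orderR (μ : ProbabilityMeasure Phase) : ℝ := ‖centerOfMass μ‖

/-- The mean phase `φ`, where `R e^{iφ} = ∫ e^{iϑ} dμ(ϑ)`. It is meaningful only for `R ≠ 0`,
and it enters the equation only through the product `R sin(ϑ - φ)`. -/
def meanPhase (μ : ProbabilityMeasure Phase) : Phase :=
  ((centerOfMass μ).arg : Real.Angle)

/-- The velocity field `v(ϑ) = -R sin(ϑ - φ)` generated by a distribution of phases. -/
def velocity (μ : ProbabilityMeasure Phase) (θ : Phase) : ℝ :=
  -orderR μ * Real.Angle.sin (θ - meanPhase μ)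

/-- The velocity field is the mean-field one, `v(ϑ) = -∫ sin(ϑ - ϑ') dμ(ϑ')`. -/
theorem velocity_eq_integral (μ : ProbabilityMeasure Phase) (θ : Phase) :
    velocity μ θ = -∫ θ' : Phase, Real.Angle.sin (θ - θ') ∂(μ : Measure Phase) := by
  have hcosI : Integrable (fun θ' : Phase => θ'.cos) (μ : Measure Phase) :=
    Integrable.of_bound Real.Angle.continuous_cos.aestronglyMeasurable 1
      (Eventually.of_forall fun x => by
        induction x using Real.Angle.induction_on with
        | _ x => simpa using Real.abs_cos_le_one x)
  have hsinI : Integrable (fun θ' : Phase => θ'.sin) (μ : Measure Phase) :=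
    Integrable.of_bound Real.Angle.continuous_sin.aestronglyMeasurable 1
      (Eventually.of_forall fun x => by
        induction x using Real.Angle.induction_on with
        | _ x => simpa using Real.abs_sin_le_one x)
  have hz : centerOfMass μ = ((∫ θ' : Phase, θ'.cos ∂(μ : Measure Phase) : ℝ) : ℂ)
      + ((∫ θ' : Phase, θ'.sin ∂(μ : Measure Phase) : ℝ) : ℂ) * Complex.I := by
    simp only [centerOfMass, Real.Angle.coe_toCircle]
    rw [integral_add hcosI.ofReal (hsinI.ofReal.mul_const _), integral_mul_const,
      integral_complex_ofReal, integral_complex_ofReal]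
  have hre : ∫ θ' : Phase, θ'.cos ∂(μ : Measure Phase) = (centerOfMass μ).re := by
    simp [hz]
  have him : ∫ θ' : Phase, θ'.sin ∂(μ : Measure Phase) = (centerOfMass μ).im := by
    simp [hz]
  have hsub : ∀ a b : Phase, (a - b).sin = a.sin * b.cos - a.cos * b.sin := by
    intro a b
    rw [sub_eq_add_neg, Real.Angle.sin_add, Real.Angle.sin_neg, Real.Angle.cos_neg]
    ring
  have e1 : orderR μ * Real.Angle.cos (meanPhase μ) = (centerOfMass μ).re := by
    simp [orderR, meanPhase]
  have e2 : orderR μ * Real.Angle.sin (meanPhase μ) = (centerOfMass μ).im := by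
    simp [orderR, meanPhase]
  have hI : ∫ θ' : Phase, Real.Angle.sin (θ - θ') ∂(μ : Measure Phase)
      = Real.Angle.sin θ * (centerOfMass μ).re - Real.Angle.cos θ * (centerOfMass μ).im := by
    simp_rw [hsub]
    rw [integral_sub (hcosI.const_mul _) (hsinI.const_mul _), integral_const_mul,
      integral_const_mul, hre, him]
  rw [hI, velocity, hsub, ← e1, ← e2]
  ring

/-- `x : ℝ → 𝕋` solves `ẋ(t) = v(t, x(t))` for `t ≥ 0`, where `v(t, ·)` is the velocity field
of `ρ t`: a real-valued lift of `x` is differentiable with this derivative (one-sided at `0`). -/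
def IsCharacteristic (ρ : ℝ → ProbabilityMeasure Phase) (x : ℝ → Phase) : Prop :=
  ∃ y : ℝ → ℝ, ∀ t : ℝ, 0 ≤ t →
    (y t : Phase) = x t ∧ HasDerivWithinAt y (velocity (ρ t) (x t)) (Ici 0) t

/-- `ρ`, restricted to times `t ≥ 0`, is a measure-valued solution of the kinetic Kuramoto
equation `∂ₜρ + ∂_ϑ(vρ) = 0`, `v(t, ϑ) = -∫ sin(ϑ - ϑ') ρ(t, dϑ')`: there is a flow `Θ` of
characteristics, `Θ(0, ϑ) = ϑ`, that transports the initial datum,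
`∫ h(ϑ) ρ(t, dϑ) = ∫ h(Θ(t, ϑ)) ρ(0, dϑ)` for every observable `h`. -/
def IsSolution (ρ : ℝ → ProbabilityMeasure Phase) : Prop :=
  ∃ Θ : ℝ → Phase → Phase,
    (∀ θ, Θ 0 θ = θ) ∧
    (∀ θ, IsCharacteristic ρ fun t => Θ t θ) ∧
    ∀ t : ℝ, 0 ≤ t → ∀ h : C(Phase, ℝ),
      ∫ θ, h θ ∂(ρ t : Measure Phase) = ∫ θ, h (Θ t θ) ∂(ρ 0 : Measure Phase)

/-- `ρ` is constant in time on `[0, ∞)`. -/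
def IsStationary (ρ : ℝ → ProbabilityMeasure Phase) : Prop :=
  ∀ t : ℝ, 0 ≤ t → ρ t = ρ 0

/-- `μ = c₁ δ_φ + c₂ δ_{φ + π}` with `c₁ > c₂ ≥ 0` and `c₁ + c₂ = 1`. -/
def IsTwoDelta (μ : ProbabilityMeasure Phase) (c₁ c₂ : ℝ) (φ : Phase) : Prop :=
  c₂ < c₁ ∧ 0 ≤ c₂ ∧ c₁ + c₂ = 1 ∧
    (μ : Measure Phase) = ENNReal.ofReal c₁ • Measure.dirac φ
      + ENNReal.ofReal c₂ • Measure.dirac (φ + ((Real.pi : ℝ) : Phase))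

end Kuramoto

end

/-! Write the mean as `(a, b)`, with squared length `q = R²`, and split each oscillator into its
components `s = R sin(ϑ - φ)` and `c = R cos(ϑ - φ)` relative to the mean. Then `q' = 2P` with `P =
∫ s²`, and `q ≤ 1`, so `P` is integrable in time. If `q` vanishes at all positive times, nothing
moves; hence a nonstationary solution has `q` bounded below from some `t₀` on.

The difficulty is that the mean phase might keep rotating. Its angular speed is `-K/q` with `K = ∫ c
s`, and monotonicity of `q` says nothing about it. The key identity is `K' = K + 2 ∫ s³`. The
forcing is at most `2P` in absolute value, hence integrable, and the linear part is unstable, so the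
bounded solution `K` must itself be integrable (`integrableOn_Ioi_of_hasDerivAt_self_add`). The
derivative of the mean is then integrable and the mean converges to some `R e^{iφ}` with `R > 0`.
The derivative of `P` is integrable too, so `P → 0` and the mass concentrates where `sin(ϑ - φ) =
0`. The limit of `∫ cos(ϑ - φ)` fixes the masses `(1 ± R)/2` at `φ` and `φ + π`.

For non-atomic data, trajectories eventually cannot enter the region opposite to the mean
(`exists_forward_invariant`), and any two that stay there forever separate exponentially, which is
impossible on a circle. At most one initial phase is thus exceptional; it has measure zero, so no
mass is left at `φ + π` and `R = 1`. -/

namespace Kuramoto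

/-! ### Real analysis on a half-line -/

/-- A function with nonnegative derivative on `[a, ∞)` that is bounded above has an integrable
derivative. -/
theorem integrableOn_Ioi_of_hasDerivAt_of_nonneg_of_le {g g' : ℝ → ℝ} {a M : ℝ}
    (hg : ∀ t ∈ Ici a, HasDerivAt g (g' t) t) (hg' : ∀ t ∈ Ici a, 0 ≤ g' t)
    (hM : ∀ t ∈ Ici a, g t ≤ M) : IntegrableOn g' (Ioi a) := by
  have hmono : MonotoneOn g (Ici a) := by
    refine monotoneOn_of_deriv_nonneg (convex_Ici a)
      (fun t ht => (hg t ht).continuousAt.continuousWithinAt)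
      (fun t ht => (hg t (interior_subset ht)).differentiableAt.differentiableWithinAt) ?_
    intro t ht
    rw [(hg t (interior_subset ht)).deriv]
    exact hg' t (interior_subset ht)
  have hmono' : Monotone fun t => g (max a t) := fun s t hst =>
    hmono (le_max_left a s) (le_max_left a t) (max_le_max_left a hst)
  have hbdd : BddAbove (range fun t => g (max a t)) :=
    ⟨M, by rintro _ ⟨t, rfl⟩; exact hM _ (le_max_left a t)⟩
  have hlim := tendsto_atTop_ciSup hmono' hbdd
  refine integrableOn_Ioi_deriv_of_nonneg' hg (fun t ht => hg' t (mem_Ioi.1 ht).le)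
    (hlim.congr' ?_)
  filter_upwards [eventually_ge_atTop a] with t ht
  rw [max_eq_right ht]

/-- If `f' = f + g` with `g` integrable, then the solution `f` is unstable: if it stays bounded
it is integrable. -/
theorem integrableOn_Ioi_of_hasDerivAt_self_add {f g : ℝ → ℝ} {a M : ℝ}
    (hf : ∀ t ∈ Ici a, HasDerivAt f (f t + g t) t) (hM : ∀ t ∈ Ici a, |f t| ≤ M)
    (hg : IntegrableOn g (Ioi a)) : IntegrableOn f (Ioi a) := by
  have hfc : ContinuousOn f (Ici a) := fun t ht => (hf t ht).continuousAt.continuousWithinAt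
  refine integrableOn_Ioi_of_intervalIntegral_norm_bounded (l := atTop) (b := id)
    (M + 2 + ∫ t in Ioi a, |g t|) a ?_ tendsto_id ?_
  · intro T
    exact ((hfc.mono Icc_subset_Ici_self).integrableOn_Icc).mono_set Ioc_subset_Icc_self
  filter_upwards [eventually_gt_atTop a] with T hT
  simp only [id]
  -- The function `√(f² + ε²)` is a smooth substitute for `|f|`, with derivative at least `|f| - ε -
  -- |g|`. Taking `ε` small in terms of `T` keeps the accumulated error on `[a, T]` below `1`; `ε ≤
  -- 1` bounds the endpoint value by `M + 1`. Together these give the constant `M + 2`.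
  obtain ⟨ε, hε0, hε1, hεT⟩ : ∃ ε : ℝ, 0 < ε ∧ ε ≤ 1 ∧ ε * (T - a) ≤ 1 := by
    have hpos : 0 < 1 + (T - a) := by linarith
    refine ⟨1 / (1 + (T - a)), by positivity, ?_, ?_⟩
    · rw [div_le_one hpos]; linarith
    · rw [div_mul_eq_mul_div, div_le_one hpos]; linarith
  set E : ℝ → ℝ := fun t => √(f t ^ 2 + ε ^ 2) with hE
  have hpos : ∀ t, 0 < f t ^ 2 + ε ^ 2 := fun t => by positivity
  have hEpos : ∀ t, 0 < E t := fun t => Real.sqrt_pos.2 (hpos t)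
  have hEsq : ∀ t, E t ^ 2 = f t ^ 2 + ε ^ 2 := fun t => Real.sq_sqrt (hpos t).le
  have hfE : ∀ t, |f t| ≤ E t := fun t => Real.abs_le_sqrt (by nlinarith)
  have hεE : ∀ t, ε ≤ E t := fun t => Real.le_sqrt_of_sq_le (by nlinarith [sq_nonneg (f t)])
  have hEd : ∀ t ∈ Ici a, HasDerivAt E ((f t * (f t + g t)) / E t) t := by
    intro t ht
    have h := ((((hf t ht).pow 2).add_const (ε ^ 2)).sqrt (hpos t).ne')
    refine HasDerivAt.congr_deriv (f := E) h ?_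
    change _ / (2 * E t) = _
    have := (hEpos t).ne'
    norm_num
    field_simp
  have hEc : ContinuousOn E (Icc a T) := fun t ht =>
    (hEd t ht.1).continuousAt.continuousWithinAt
  have hgI : IntegrableOn (fun t => |g t|) (Icc a T) :=
    ((integrableOn_Icc_iff_integrableOn_Ioc (by simp)).2 (hg.mono_set Ioc_subset_Ioi_self)).abs
  have hφ : IntegrableOn (fun t => |f t| - (ε + |g t|)) (Icc a T) :=
    ((hfc.mono Icc_subset_Ici_self).abs.integrableOn_Icc).sub
      ((continuousOn_const.integrableOn_Icc).add hgI)
  have key := intervalIntegral.integral_le_sub_of_hasDeriv_right_of_le hT.le hEc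
    (fun t ht => (hEd t ht.1.le).hasDerivWithinAt) hφ (fun t ht => by
      rw [le_div_iff₀ (hEpos t)]
      have h1 : -(f t * g t) ≤ |g t| * E t := by
        have := neg_abs_le (f t * g t)
        rw [abs_mul] at this
        nlinarith [hfE t, abs_nonneg (g t)]
      nlinarith [hfE t, hεE t, hEsq t, hEpos t, abs_nonneg (f t)])
  have hI1 : IntervalIntegrable (fun t => |f t|) volume a T :=
    (intervalIntegrable_iff_integrableOn_Icc_of_le hT.le).2
      ((hfc.mono Icc_subset_Ici_self).abs.integrableOn_Icc)
  have hI2 : IntervalIntegrable (fun t => |g t|) volume a T :=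
    (intervalIntegrable_iff_integrableOn_Icc_of_le hT.le).2 hgI
  rw [intervalIntegral.integral_sub hI1 (intervalIntegrable_const.add hI2),
    intervalIntegral.integral_add intervalIntegrable_const hI2,
    intervalIntegral.integral_const] at key
  have hgle : ∫ t in a..T, |g t| ≤ ∫ t in Ioi a, |g t| := by
    rw [intervalIntegral.integral_of_le hT.le]
    exact setIntegral_mono_set hg.abs (Eventually.of_forall fun t => abs_nonneg _)
      (Ioc_subset_Ioi_self.eventuallyLE)
  have hET : E T ≤ M + 1 := by
    have h1 := hM T hT.le
    refine Real.sqrt_le_iff.2 ⟨by linarith [abs_nonneg (f T)], ?_⟩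
    nlinarith [abs_nonneg (f T), sq_abs (f T)]
  simp only [Real.norm_eq_abs, smul_eq_mul] at *
  linarith [(hEpos a).le, mul_comm ε (T - a)]

/-- Differentiation under the integral sign for bounded families on a finite measure space. -/
theorem hasDerivAt_integral_of_bounded {Ω : Type*} [MeasurableSpace Ω] {ν : Measure Ω}
    [IsFiniteMeasure ν] {F F' : ℝ → Ω → ℝ} {C : ℝ} {t : ℝ} (ht : 0 < t)
    (hF : ∀ r, Measurable (F r)) (hFC : ∀ ω, |F t ω| ≤ C) (hF' : Measurable (F' t))
    (hbd : ∀ r, 0 < r → ∀ ω, |F' r ω| ≤ C)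
    (hd : ∀ r, 0 < r → ∀ ω, HasDerivAt (fun r => F r ω) (F' r ω) r) :
    HasDerivAt (fun r => ∫ ω, F r ω ∂ν) (∫ ω, F' t ω ∂ν) t :=
  (hasDerivAt_integral_of_dominated_loc_of_deriv_le (bound := fun _ => C)
    (Ioi_mem_nhds ht)
    (Eventually.of_forall fun r => (hF r).aestronglyMeasurable)
    (Integrable.of_bound (hF t).aestronglyMeasurable C (Eventually.of_forall hFC))
    hF'.aestronglyMeasurable
    (Eventually.of_forall fun ω r hr => hbd r hr ω)
    (integrable_const C)
    (Eventually.of_forall fun ω r hr => hd r hr ω)).2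

/-! ### Mean-field flows on the unit circle -/

/-- A family of points `(X t ω, Y t ω)` of the unit circle, indexed by a measure space, that moves
for `t > 0` with angular velocity `-(a Y - b X)`, where `(a, b)` is the mean of `(X, Y)`. -/
structure CircleFlow {Ω : Type*} [MeasurableSpace Ω] (ν : Measure Ω) where
  /-- The first coordinate. -/
  X : ℝ → Ω → ℝ
  /-- The second coordinate. -/
  Y : ℝ → Ω → ℝ
  sq_add_sq : ∀ t ω, X t ω ^ 2 + Y t ω ^ 2 = 1
  measurable_X : ∀ t, Measurable (X t)
  measurable_Y : ∀ t, Measurable (Y t)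
  hasDerivAt_X' : ∀ t, 0 < t → ∀ ω, HasDerivAt (fun r => X r ω)
    (((∫ ω', X t ω' ∂ν) * Y t ω - (∫ ω', Y t ω' ∂ν) * X t ω) * Y t ω) t
  hasDerivAt_Y' : ∀ t, 0 < t → ∀ ω, HasDerivAt (fun r => Y r ω)
    (-((∫ ω', X t ω' ∂ν) * Y t ω - (∫ ω', Y t ω' ∂ν) * X t ω) * X t ω) t

namespace CircleFlow

variable {Ω : Type*} [MeasurableSpace Ω] {ν : Measure Ω} (F : CircleFlow ν)

/-- The mean of the first coordinate. -/
noncomputable def a (t : ℝ) : ℝ := ∫ ω, F.X t ω ∂ν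

/-- The mean of the second coordinate. -/
noncomputable def b (t : ℝ) : ℝ := ∫ ω, F.Y t ω ∂ν

/-- `s = R sin(ϑ - φ)`, the component transverse to the mean, times its length. -/
noncomputable def s (t : ℝ) (ω : Ω) : ℝ := F.a t * F.Y t ω - F.b t * F.X t ω

/-- `c = R cos(ϑ - φ)`, the component along the mean, times its length. -/
noncomputable def c (t : ℝ) (ω : Ω) : ℝ := F.a t * F.X t ω + F.b t * F.Y t ω

/-- The squared order parameter `R²`. -/
noncomputable def q (t : ℝ) : ℝ := F.a t ^ 2 + F.b t ^ 2

/-- The dissipation `R² ∫ sin²(ϑ - φ)`. -/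
noncomputable def P (t : ℝ) : ℝ := ∫ ω, F.s t ω ^ 2 ∂ν

/-- `R² ∫ sin(ϑ - φ) cos(ϑ - φ)`, which governs the rotation of the mean phase. -/
noncomputable def K (t : ℝ) : ℝ := ∫ ω, F.c t ω * F.s t ω ∂ν

theorem hasDerivAt_X {t : ℝ} (ht : 0 < t) (ω : Ω) :
    HasDerivAt (fun r => F.X r ω) (F.s t ω * F.Y t ω) t := F.hasDerivAt_X' t ht ω

theorem hasDerivAt_Y {t : ℝ} (ht : 0 < t) (ω : Ω) :
    HasDerivAt (fun r => F.Y r ω) (-F.s t ω * F.X t ω) t := F.hasDerivAt_Y' t ht ω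

theorem abs_X_le (t : ℝ) (ω : Ω) : |F.X t ω| ≤ 1 :=
  abs_le_one_iff_mul_self_le_one.2 (by nlinarith [F.sq_add_sq t ω, sq_nonneg (F.Y t ω)])

theorem abs_Y_le (t : ℝ) (ω : Ω) : |F.Y t ω| ≤ 1 :=
  abs_le_one_iff_mul_self_le_one.2 (by nlinarith [F.sq_add_sq t ω, sq_nonneg (F.X t ω)])

theorem s_sq_add_c_sq (t : ℝ) (ω : Ω) : F.s t ω ^ 2 + F.c t ω ^ 2 = F.q t := by
  have h := F.sq_add_sq t ω
  simp only [s, c, q]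
  linear_combination (F.a t ^ 2 + F.b t ^ 2) * h

theorem measurable_s (t : ℝ) : Measurable (F.s t) :=
  ((F.measurable_Y t).const_mul _).sub ((F.measurable_X t).const_mul _)

theorem measurable_c (t : ℝ) : Measurable (F.c t) :=
  ((F.measurable_X t).const_mul _).add ((F.measurable_Y t).const_mul _)

theorem q_nonneg (t : ℝ) : 0 ≤ F.q t := by unfold q; positivity

theorem P_nonneg (t : ℝ) : 0 ≤ F.P t := integral_nonneg fun _ => sq_nonneg _

/-- The derivative of `s` along the flow, before the mean field equations are inserted. -/
noncomputable def sDot (t : ℝ) (ω : Ω) : ℝ :=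
  (∫ ω', F.s t ω' * F.Y t ω' ∂ν) * F.Y t ω - (∫ ω', -F.s t ω' * F.X t ω' ∂ν) * F.X t ω
    - F.s t ω * F.c t ω

/-- The derivative of `c` along the flow, before the mean field equations are inserted. -/
noncomputable def cDot (t : ℝ) (ω : Ω) : ℝ :=
  (∫ ω', F.s t ω' * F.Y t ω' ∂ν) * F.X t ω + (∫ ω', -F.s t ω' * F.X t ω' ∂ν) * F.Y t ω
    + F.s t ω ^ 2

theorem measurable_sDot (t : ℝ) : Measurable (F.sDot t) :=
  (((F.measurable_Y t).const_mul _).sub ((F.measurable_X t).const_mul _)).sub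
    ((F.measurable_s t).mul (F.measurable_c t))

theorem measurable_cDot (t : ℝ) : Measurable (F.cDot t) :=
  (((F.measurable_X t).const_mul _).add ((F.measurable_Y t).const_mul _)).add
    ((F.measurable_s t).pow_const 2)

variable [IsProbabilityMeasure ν]

theorem integrable_X (t : ℝ) : Integrable (F.X t) ν :=
  Integrable.of_bound (F.measurable_X t).aestronglyMeasurable 1
    (Eventually.of_forall (F.abs_X_le t))

theorem integrable_Y (t : ℝ) : Integrable (F.Y t) ν :=
  Integrable.of_bound (F.measurable_Y t).aestronglyMeasurable 1
    (Eventually.of_forall (F.abs_Y_le t))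

theorem integral_s (t : ℝ) : ∫ ω, F.s t ω ∂ν = 0 := by
  simp only [s]
  rw [integral_sub ((F.integrable_Y t).const_mul _) ((F.integrable_X t).const_mul _),
    integral_const_mul, integral_const_mul]
  simp only [a, b]
  ring

theorem integral_c (t : ℝ) : ∫ ω, F.c t ω ∂ν = F.q t := by
  simp only [c]
  rw [integral_add ((F.integrable_X t).const_mul _) ((F.integrable_Y t).const_mul _),
    integral_const_mul, integral_const_mul]
  simp only [q, a, b]
  ring

theorem integrable_c (t : ℝ) : Integrable (F.c t) ν :=
  ((F.integrable_X t).const_mul _).add ((F.integrable_Y t).const_mul _)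

/-- Expanding `|(X, Y) - (a, b)|² ≥ 0` on the unit circle gives `2c ≤ q + 1`; since `∫ c = q`,
integration concludes. -/
theorem q_le_one (t : ℝ) : F.q t ≤ 1 := by
  have h : ∫ ω, F.c t ω ∂ν ≤ ∫ _ω, (F.q t + 1) / 2 ∂ν := by
    refine integral_mono (F.integrable_c t) (integrable_const _) fun ω => ?_
    simp only [c, q]
    nlinarith [F.sq_add_sq t ω, sq_nonneg (F.a t - F.X t ω), sq_nonneg (F.b t - F.Y t ω)]
  rw [integral_c] at h
  simp at h
  linarith

theorem abs_s_le (t : ℝ) (ω : Ω) : |F.s t ω| ≤ 1 :=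
  abs_le_one_iff_mul_self_le_one.2
    (by nlinarith [F.s_sq_add_c_sq t ω, F.q_le_one t, sq_nonneg (F.c t ω)])

theorem abs_c_le (t : ℝ) (ω : Ω) : |F.c t ω| ≤ 1 :=
  abs_le_one_iff_mul_self_le_one.2
    (by nlinarith [F.s_sq_add_c_sq t ω, F.q_le_one t, sq_nonneg (F.s t ω)])

theorem abs_a_le (t : ℝ) : |F.a t| ≤ 1 :=
  abs_le_one_iff_mul_self_le_one.2
    (by have := F.q_le_one t; simp only [q] at this; nlinarith [sq_nonneg (F.b t)])

theorem abs_b_le (t : ℝ) : |F.b t| ≤ 1 :=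
  abs_le_one_iff_mul_self_le_one.2
    (by have := F.q_le_one t; simp only [q] at this; nlinarith [sq_nonneg (F.a t)])

theorem integrable_s (t : ℝ) : Integrable (F.s t) ν :=
  ((F.integrable_Y t).const_mul _).sub ((F.integrable_X t).const_mul _)

theorem integrable_s_mul {t : ℝ} {f : Ω → ℝ} (hf : Integrable f ν) :
    Integrable (fun ω => F.s t ω * f ω) ν :=
  hf.bdd_mul (F.measurable_s t).aestronglyMeasurable (Eventually.of_forall (F.abs_s_le t))

theorem integrable_s_sq (t : ℝ) : Integrable (fun ω => F.s t ω ^ 2) ν := by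
  simpa only [sq] using F.integrable_s_mul (F.integrable_s t)

theorem integrable_s_cube (t : ℝ) : Integrable (fun ω => F.s t ω ^ 3) ν := by
  simpa only [pow_succ' _ 2] using F.integrable_s_mul (F.integrable_s_sq t)

theorem integrable_c_mul_s (t : ℝ) : Integrable (fun ω => F.c t ω * F.s t ω) ν := by
  simpa only [mul_comm] using F.integrable_s_mul (F.integrable_c t)

theorem abs_integral_le_of_abs_le {f : Ω → ℝ} {C : ℝ} (hf : ∀ ω, |f ω| ≤ C) :
    |∫ ω, f ω ∂ν| ≤ C := by
  simpa using norm_integral_le_of_norm_le_const (μ := ν) (f := f) (Eventually.of_forall hf)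

theorem P_le_one (t : ℝ) : F.P t ≤ 1 :=
  (le_abs_self _).trans <| abs_integral_le_of_abs_le fun ω => by
    rw [abs_pow]; exact pow_le_one₀ (abs_nonneg _) (F.abs_s_le t ω)

theorem abs_K_le (t : ℝ) : |F.K t| ≤ 1 :=
  abs_integral_le_of_abs_le fun ω => by
    rw [abs_mul]; exact mul_le_one₀ (F.abs_c_le t ω) (abs_nonneg _) (F.abs_s_le t ω)

/-- From `q Y = a s + b c`: the Cartesian coordinates are recovered from the components relative to
the mean. The factor `q` stays on the left so that no positivity is needed. -/
theorem integral_s_mul_Y (t : ℝ) :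
    F.q t * ∫ ω, F.s t ω * F.Y t ω ∂ν = F.a t * F.P t + F.b t * F.K t := by
  simp only [P, K]
  rw [← integral_const_mul, ← integral_const_mul, ← integral_const_mul,
    ← integral_add ((F.integrable_s_sq t).const_mul _) ((F.integrable_c_mul_s t).const_mul _)]
  refine integral_congr_ae (Eventually.of_forall fun ω => ?_)
  simp only [q, s, c]
  ring

theorem integral_s_mul_X (t : ℝ) :
    F.q t * ∫ ω, -F.s t ω * F.X t ω ∂ν = F.b t * F.P t - F.a t * F.K t := by
  simp only [P, K]
  rw [← integral_const_mul, ← integral_const_mul, ← integral_const_mul,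
    ← integral_sub ((F.integrable_s_sq t).const_mul _) ((F.integrable_c_mul_s t).const_mul _)]
  refine integral_congr_ae (Eventually.of_forall fun ω => ?_)
  simp only [q, s, c]
  ring

theorem abs_s_mul_Y_le (t : ℝ) (ω : Ω) : |F.s t ω * F.Y t ω| ≤ 1 := by
  rw [abs_mul]; exact mul_le_one₀ (F.abs_s_le t ω) (abs_nonneg _) (F.abs_Y_le t ω)

theorem abs_s_mul_X_le (t : ℝ) (ω : Ω) : |-F.s t ω * F.X t ω| ≤ 1 := by
  rw [abs_mul, abs_neg]; exact mul_le_one₀ (F.abs_s_le t ω) (abs_nonneg _) (F.abs_X_le t ω)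

/-! ### Evolution equations for the mean, `R²`, `K` and `P` -/

theorem hasDerivAt_a_integral {t : ℝ} (ht : 0 < t) :
    HasDerivAt F.a (∫ ω, F.s t ω * F.Y t ω ∂ν) t :=
  hasDerivAt_integral_of_bounded (C := 1) (F' := fun r ω => F.s r ω * F.Y r ω) ht
    F.measurable_X (F.abs_X_le t) ((F.measurable_s t).mul (F.measurable_Y t))
    (fun r _ => F.abs_s_mul_Y_le r) (fun _ hr => F.hasDerivAt_X hr)

theorem hasDerivAt_b_integral {t : ℝ} (ht : 0 < t) :
    HasDerivAt F.b (∫ ω, -F.s t ω * F.X t ω ∂ν) t :=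
  hasDerivAt_integral_of_bounded (C := 1) (F' := fun r ω => -F.s r ω * F.X r ω) ht
    F.measurable_Y (F.abs_Y_le t) ((F.measurable_s t).neg.mul (F.measurable_X t))
    (fun r _ => F.abs_s_mul_X_le r) (fun _ hr => F.hasDerivAt_Y hr)

/-- The order parameter increases: `(R²)' = 2 P`. -/
theorem hasDerivAt_q {t : ℝ} (ht : 0 < t) : HasDerivAt F.q (2 * F.P t) t := by
  have h := ((F.hasDerivAt_a_integral ht).pow 2).add ((F.hasDerivAt_b_integral ht).pow 2)
  refine HasDerivAt.congr_deriv (f := F.q) h ?_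
  have e : F.P t = F.a t * (∫ ω, F.s t ω * F.Y t ω ∂ν)
      + F.b t * ∫ ω, -F.s t ω * F.X t ω ∂ν := by
    simp only [P]
    rw [← integral_const_mul, ← integral_const_mul, ← integral_add]
    · refine integral_congr_ae (Eventually.of_forall fun ω => ?_)
      simp only [s]
      ring
    · exact (F.integrable_s_mul (F.integrable_Y t)).const_mul _
    · simp only [neg_mul]
      exact (F.integrable_s_mul (F.integrable_X t)).neg.const_mul _
  rw [e]
  norm_num
  ring

theorem monotoneOn_q : MonotoneOn F.q (Ioi 0) := by
  refine monotoneOn_of_deriv_nonneg (convex_Ioi 0)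
    (fun t ht => (F.hasDerivAt_q ht).continuousAt.continuousWithinAt)
    (fun t ht => (F.hasDerivAt_q (interior_subset ht)).differentiableAt.differentiableWithinAt) ?_
  intro t ht
  rw [(F.hasDerivAt_q (interior_subset ht)).deriv]
  linarith [F.P_nonneg t]

theorem hasDerivAt_a {t : ℝ} (ht : 0 < t) (hq : 0 < F.q t) :
    HasDerivAt F.a ((F.a t * F.P t + F.b t * F.K t) / F.q t) t := by
  rw [← F.integral_s_mul_Y, mul_div_cancel_left₀ _ hq.ne']
  exact F.hasDerivAt_a_integral ht

theorem hasDerivAt_b {t : ℝ} (ht : 0 < t) (hq : 0 < F.q t) :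
    HasDerivAt F.b ((F.b t * F.P t - F.a t * F.K t) / F.q t) t := by
  rw [← F.integral_s_mul_X, mul_div_cancel_left₀ _ hq.ne']
  exact F.hasDerivAt_b_integral ht

theorem hasDerivAt_s {t : ℝ} (ht : 0 < t) (ω : Ω) :
    HasDerivAt (fun r => F.s r ω) (F.sDot t ω) t := by
  have h := ((F.hasDerivAt_a_integral ht).mul (F.hasDerivAt_Y ht ω)).sub
    ((F.hasDerivAt_b_integral ht).mul (F.hasDerivAt_X ht ω))
  refine HasDerivAt.congr_deriv (f := fun r => F.s r ω) h ?_
  simp only [sDot, c]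
  ring

theorem hasDerivAt_c {t : ℝ} (ht : 0 < t) (ω : Ω) :
    HasDerivAt (fun r => F.c r ω) (F.cDot t ω) t := by
  have h := ((F.hasDerivAt_a_integral ht).mul (F.hasDerivAt_X ht ω)).add
    ((F.hasDerivAt_b_integral ht).mul (F.hasDerivAt_Y ht ω))
  refine HasDerivAt.congr_deriv (f := fun r => F.c r ω) h ?_
  have e : F.s t ω ^ 2 = F.s t ω * (F.a t * F.Y t ω - F.b t * F.X t ω) := by rw [sq]; rfl
  simp only [cDot]
  rw [e]
  ring

/-- Differentiation under the integral needs a bound uniform over all positive times, including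
those with `q = 0`; this is why `sDot` is defined without dividing by `q`. -/
theorem abs_sDot_le (t : ℝ) (ω : Ω) : |F.sDot t ω| ≤ 3 := by
  have h1 : |(∫ ω', F.s t ω' * F.Y t ω' ∂ν) * F.Y t ω| ≤ 1 := by
    rw [abs_mul]
    exact mul_le_one₀ (abs_integral_le_of_abs_le (F.abs_s_mul_Y_le t)) (abs_nonneg _)
      (F.abs_Y_le t ω)
  have h2 : |(∫ ω', -F.s t ω' * F.X t ω' ∂ν) * F.X t ω| ≤ 1 := by
    rw [abs_mul]
    exact mul_le_one₀ (abs_integral_le_of_abs_le (F.abs_s_mul_X_le t)) (abs_nonneg _)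
      (F.abs_X_le t ω)
  have h3 : |F.s t ω * F.c t ω| ≤ 1 := by
    rw [abs_mul]; exact mul_le_one₀ (F.abs_s_le t ω) (abs_nonneg _) (F.abs_c_le t ω)
  unfold sDot
  rw [abs_le] at *
  constructor <;> linarith

theorem abs_cDot_le (t : ℝ) (ω : Ω) : |F.cDot t ω| ≤ 3 := by
  have h1 : |(∫ ω', F.s t ω' * F.Y t ω' ∂ν) * F.X t ω| ≤ 1 := by
    rw [abs_mul]
    exact mul_le_one₀ (abs_integral_le_of_abs_le (F.abs_s_mul_Y_le t)) (abs_nonneg _)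
      (F.abs_X_le t ω)
  have h2 : |(∫ ω', -F.s t ω' * F.X t ω' ∂ν) * F.Y t ω| ≤ 1 := by
    rw [abs_mul]
    exact mul_le_one₀ (abs_integral_le_of_abs_le (F.abs_s_mul_X_le t)) (abs_nonneg _)
      (F.abs_Y_le t ω)
  have h3 : |F.s t ω ^ 2| ≤ 1 := by
    rw [abs_pow]; exact pow_le_one₀ (abs_nonneg _) (F.abs_s_le t ω)
  unfold cDot
  rw [abs_le] at *
  constructor <;> linarith

theorem sDot_eq {t : ℝ} (hq : 0 < F.q t) (ω : Ω) :
    F.sDot t ω = (F.P t * F.s t ω + F.K t * F.c t ω) / F.q t - F.s t ω * F.c t ω := by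
  have e1 := F.integral_s_mul_Y t
  have e2 := F.integral_s_mul_X t
  rw [eq_sub_iff_add_eq, eq_div_iff hq.ne']
  simp only [sDot]
  simp only [sub_add_cancel]
  rw [show F.P t * F.s t ω + F.K t * F.c t ω = (F.a t * F.P t + F.b t * F.K t) * F.Y t ω
      - (F.b t * F.P t - F.a t * F.K t) * F.X t ω by simp only [s, c]; ring, ← e1, ← e2]
  ring

theorem cDot_eq {t : ℝ} (hq : 0 < F.q t) (ω : Ω) :
    F.cDot t ω = (F.P t * F.c t ω - F.K t * F.s t ω) / F.q t + F.s t ω ^ 2 := by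
  have e1 := F.integral_s_mul_Y t
  have e2 := F.integral_s_mul_X t
  rw [← sub_eq_iff_eq_add, eq_div_iff hq.ne']
  simp only [cDot]
  simp only [add_sub_cancel_right]
  rw [show F.P t * F.c t ω - F.K t * F.s t ω = (F.a t * F.P t + F.b t * F.K t) * F.X t ω
      + (F.b t * F.P t - F.a t * F.K t) * F.Y t ω by simp only [s, c]; ring, ← e1, ← e2]
  ring

/-- The equation `K' = K + 2 ∫ s³`. -/
theorem hasDerivAt_K {t : ℝ} (ht : 0 < t) (hq : 0 < F.q t) :
    HasDerivAt F.K (F.K t + 2 * ∫ ω, F.s t ω ^ 3 ∂ν) t := by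
  have h := hasDerivAt_integral_of_bounded (ν := ν) (C := 6) (F := fun r ω => F.c r ω * F.s r ω)
    (F' := fun r ω => F.cDot r ω * F.s r ω + F.c r ω * F.sDot r ω) ht
    (fun r => (F.measurable_c r).mul (F.measurable_s r))
    (fun ω => by
      rw [abs_mul]
      exact (mul_le_one₀ (F.abs_c_le t ω) (abs_nonneg _) (F.abs_s_le t ω)).trans (by norm_num))
    (((F.measurable_cDot t).mul (F.measurable_s t)).add
      ((F.measurable_c t).mul (F.measurable_sDot t)))
    (fun r _ ω => by
      refine (abs_add_le _ _).trans ?_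
      rw [abs_mul, abs_mul]
      nlinarith [F.abs_cDot_le r ω, F.abs_sDot_le r ω, F.abs_s_le r ω, F.abs_c_le r ω,
        abs_nonneg (F.cDot r ω), abs_nonneg (F.sDot r ω), abs_nonneg (F.s r ω),
        abs_nonneg (F.c r ω)])
    (fun r hr ω => (F.hasDerivAt_c hr ω).mul (F.hasDerivAt_s hr ω))
  refine HasDerivAt.congr_deriv (f := F.K) h ?_
  -- Uses `c² = q - s²`. On integration the terms `2PK/q` from `c s` and from `s²` cancel, and `q s`
  -- drops out because `∫ s = 0`.
  have hpt : ∀ ω, F.cDot t ω * F.s t ω + F.c t ω * F.sDot t ω =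
      (F.K t + 2 * F.P t / F.q t * (F.c t ω * F.s t ω))
        + (2 * F.s t ω ^ 3 - (2 * F.K t / F.q t * F.s t ω ^ 2 + F.q t * F.s t ω)) := by
    intro ω
    rw [F.sDot_eq hq, F.cDot_eq hq]
    have e : F.c t ω ^ 2 = F.q t - F.s t ω ^ 2 := by linarith [F.s_sq_add_c_sq t ω]
    field_simp
    linear_combination (F.K t - F.q t * F.s t ω) * e
  simp_rw [hpt]
  have i1 := (F.integrable_c_mul_s t).const_mul (2 * F.P t / F.q t)
  have i2 := (F.integrable_s_cube t).const_mul 2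
  have i3 := (F.integrable_s_sq t).const_mul (2 * F.K t / F.q t)
  have i4 := (F.integrable_s t).const_mul (F.q t)
  have i34 : Integrable (fun ω => 2 * F.K t / F.q t * F.s t ω ^ 2 + F.q t * F.s t ω) ν := i3.add i4
  have i12 : Integrable (fun ω => F.K t + 2 * F.P t / F.q t * (F.c t ω * F.s t ω)) ν :=
    (integrable_const _).add i1
  have i234 : Integrable (fun ω => 2 * F.s t ω ^ 3
      - (2 * F.K t / F.q t * F.s t ω ^ 2 + F.q t * F.s t ω)) ν := i2.sub i34
  rw [integral_add i12 i234,
    integral_add (integrable_const _) i1, integral_sub i2 i34, integral_add i3 i4,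
    integral_const_mul, integral_const_mul, integral_const_mul, integral_const_mul, F.integral_s,
    show ∫ ω, F.s t ω ^ 2 ∂ν = F.P t from rfl,
    show ∫ ω, F.c t ω * F.s t ω ∂ν = F.K t from rfl]
  simp
  ring

theorem hasDerivAt_P {t : ℝ} (ht : 0 < t) :
    HasDerivAt F.P (∫ ω, 2 * F.s t ω * F.sDot t ω ∂ν) t := by
  have h := hasDerivAt_integral_of_bounded (ν := ν) (C := 6) (F := fun r ω => F.s r ω ^ 2)
    (F' := fun r ω => 2 * F.s r ω * F.sDot r ω) ht
    (fun r => (F.measurable_s r).pow_const 2)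
    (fun ω => by
      rw [abs_pow]
      exact (pow_le_one₀ (abs_nonneg _) (F.abs_s_le t ω)).trans (by norm_num))
    (((F.measurable_s t).const_mul 2).mul (F.measurable_sDot t))
    (fun r _ ω => by
      rw [abs_mul, abs_mul, abs_two]
      nlinarith [F.abs_sDot_le r ω, F.abs_s_le r ω,
        abs_nonneg (F.sDot r ω), abs_nonneg (F.s r ω)])
    (fun r hr ω => by
      refine HasDerivAt.congr_deriv (f := fun r => F.s r ω ^ 2) ((F.hasDerivAt_s hr ω).pow 2) ?_
      norm_num)
  exact h

/-- Every term of `s * sDot` contains `s²` or `K`, with the other factors bounded. Once `q` is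
bounded below, this dominates `P'` by functions integrable in time. -/
theorem abs_integral_s_mul_sDot_le {t : ℝ} (hq : 0 < F.q t) :
    |∫ ω, 2 * F.s t ω * F.sDot t ω ∂ν| ≤
      (2 / F.q t + 2) * F.P t + 2 / F.q t * |F.K t| := by
  have hle : |∫ ω, 2 * F.s t ω * F.sDot t ω ∂ν| ≤
      ∫ ω, ((2 / F.q t + 2) * F.s t ω ^ 2 + 2 / F.q t * |F.K t|) ∂ν := by
    rw [← Real.norm_eq_abs]
    refine norm_integral_le_of_norm_le
      (((F.integrable_s_sq t).const_mul _).add (integrable_const _))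
      (Eventually.of_forall fun ω => ?_)
    rw [F.sDot_eq hq, Real.norm_eq_abs]
    have e : 2 * F.s t ω * ((F.P t * F.s t ω + F.K t * F.c t ω) / F.q t - F.s t ω * F.c t ω)
        = 2 / F.q t * (F.P t * F.s t ω ^ 2) + 2 / F.q t * (F.K t * (F.c t ω * F.s t ω))
          - 2 * (F.s t ω ^ 2 * F.c t ω) := by
      field_simp
    have hq' : 0 < 2 / F.q t := by positivity
    have b1 : |F.P t * F.s t ω ^ 2| ≤ F.s t ω ^ 2 := by
      rw [abs_of_nonneg (mul_nonneg (F.P_nonneg t) (sq_nonneg _))]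
      nlinarith [F.P_le_one t, sq_nonneg (F.s t ω)]
    have b2 : |F.K t * (F.c t ω * F.s t ω)| ≤ |F.K t| := by
      rw [abs_mul, abs_mul]
      exact mul_le_of_le_one_right (abs_nonneg _)
        (mul_le_one₀ (F.abs_c_le t ω) (abs_nonneg _) (F.abs_s_le t ω))
    have b3 : |F.s t ω ^ 2 * F.c t ω| ≤ F.s t ω ^ 2 := by
      rw [abs_mul, abs_of_nonneg (sq_nonneg _)]
      exact mul_le_of_le_one_right (sq_nonneg _) (F.abs_c_le t ω)
    rw [e]
    refine (abs_sub _ _).trans (le_trans (add_le_add_left (abs_add_le _ _) _) ?_)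
    rw [abs_mul (2 / F.q t), abs_mul (2 / F.q t), abs_mul 2, abs_of_pos hq', abs_two]
    nlinarith [mul_le_mul_of_nonneg_left b1 hq'.le, mul_le_mul_of_nonneg_left b2 hq'.le]
  refine hle.trans (le_of_eq ?_)
  rw [integral_add ((F.integrable_s_sq t).const_mul _) (integrable_const _), integral_const_mul]
  simp [P]

theorem abs_integral_s_cube_le (t : ℝ) : |∫ ω, F.s t ω ^ 3 ∂ν| ≤ F.P t := by
  rw [← Real.norm_eq_abs]
  refine norm_integral_le_of_norm_le (F.integrable_s_sq t) (Eventually.of_forall fun ω => ?_)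
  rw [Real.norm_eq_abs, pow_succ, abs_mul, abs_of_nonneg (sq_nonneg _)]
  exact mul_le_of_le_one_right (sq_nonneg _) (F.abs_s_le t ω)

end CircleFlow

/-- Measurability of `f'` is automatic because it is a derivative; domination does the rest. -/
theorem integrableOn_of_hasDerivAt_of_le {f f' g : ℝ → ℝ} {t₀ : ℝ}
    (hf : ∀ t ∈ Ioi t₀, HasDerivAt f (f' t) t) (hg : IntegrableOn g (Ioi t₀))
    (hle : ∀ t ∈ Ioi t₀, |f' t| ≤ g t) : IntegrableOn f' (Ioi t₀) := by
  refine Integrable.mono' hg ?_ ((ae_restrict_iff' measurableSet_Ioi).2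
    (Eventually.of_forall hle))
  exact (aestronglyMeasurable_deriv f _).congr ((ae_restrict_iff' measurableSet_Ioi).2
    (Eventually.of_forall fun t ht => (hf t ht).deriv))

/-! ### Distances between trajectories -/

/-- Grönwall: `f r * exp (-k (r - T))` is antitone. No sign is imposed on `f` or `k`, so applying it
to `-f` yields lower bounds. -/
theorem le_mul_exp_of_deriv_le_mul {f f' : ℝ → ℝ} {T k t : ℝ} (hTt : T ≤ t)
    (hc : ContinuousOn f (Ici T)) (hf : ∀ r ∈ Ioi T, HasDerivAt f (f' r) r)
    (hle : ∀ r ∈ Ioi T, f' r ≤ k * f r) : f t ≤ f T * Real.exp (k * (t - T)) := by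
  have hd : ∀ r ∈ Ioi T, HasDerivAt (fun r => f r * Real.exp (-(k * (r - T))))
      ((f' r - k * f r) * Real.exp (-(k * (r - T)))) r := by
    intro r hr
    have h1 : HasDerivAt (fun r : ℝ => -(k * (r - T))) (-k) r := by
      have h := (((hasDerivAt_id r).sub_const T).const_mul k).neg
      rw [mul_one] at h
      exact h
    refine ((hf r hr).mul h1.exp).congr_deriv ?_
    ring
  have hanti : AntitoneOn (fun r => f r * Real.exp (-(k * (r - T)))) (Ici T) := by
    refine antitoneOn_of_deriv_nonpos (convex_Ici T) (hc.mul (by fun_prop)) ?_ ?_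
    · rw [interior_Ici]
      exact fun r hr => (hd r hr).differentiableAt.differentiableWithinAt
    · rw [interior_Ici]
      intro r hr
      rw [(hd r hr).deriv]
      exact mul_nonpos_of_nonpos_of_nonneg (by linarith [hle r hr]) (Real.exp_pos _).le
  have h := hanti self_mem_Ici hTt hTt
  simp only [sub_self, mul_zero, neg_zero, Real.exp_zero, mul_one] at h
  rw [Real.exp_neg, ← div_eq_mul_inv, div_le_iff₀ (Real.exp_pos _)] at h
  exact h

/-- The squared chord between two points of the unit circle driven by the same mean field. -/
theorem hasDerivAt_chord_sq {x y x' y' : ℝ → ℝ} {a b t : ℝ}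
    (h : x t ^ 2 + y t ^ 2 = 1) (h' : x' t ^ 2 + y' t ^ 2 = 1)
    (hx : HasDerivAt x ((a * y t - b * x t) * y t) t)
    (hy : HasDerivAt y (-(a * y t - b * x t) * x t) t)
    (hx' : HasDerivAt x' ((a * y' t - b * x' t) * y' t) t)
    (hy' : HasDerivAt y' (-(a * y' t - b * x' t) * x' t) t) :
    HasDerivAt (fun r => (x r - x' r) ^ 2 + (y r - y' r) ^ 2)
      (-((a * x t + b * y t) + (a * x' t + b * y' t))
        * ((x t - x' t) ^ 2 + (y t - y' t) ^ 2)) t := by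
  refine HasDerivAt.congr_deriv (((hx.sub hx').pow 2).add ((hy.sub hy').pow 2)) ?_
  have e1 : y t ^ 2 = 1 - x t ^ 2 := by linarith
  have e2 : y' t ^ 2 = 1 - x' t ^ 2 := by linarith
  simp only [Nat.cast_ofNat, Nat.add_one_sub_one, pow_one, Pi.sub_apply]
  grind

namespace CircleFlow

variable {Ω : Type*} [MeasurableSpace Ω] {ν : Measure Ω} (F : CircleFlow ν)

theorem hasDerivAt_chord_sq {t : ℝ} (ht : 0 < t) (ω η : Ω) :
    HasDerivAt (fun r => (F.X r ω - F.X r η) ^ 2 + (F.Y r ω - F.Y r η) ^ 2)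
      (-(F.c t ω + F.c t η) * ((F.X t ω - F.X t η) ^ 2 + (F.Y t ω - F.Y t η) ^ 2)) t :=
  Kuramoto.hasDerivAt_chord_sq (F.sq_add_sq t ω) (F.sq_add_sq t η) (F.hasDerivAt_X ht ω)
    (F.hasDerivAt_Y ht ω) (F.hasDerivAt_X ht η) (F.hasDerivAt_Y ht η)

/-- Two trajectories that stay in the repelling region coincide. -/
theorem eq_of_forall_c_lt {T r : ℝ} (hT : 0 < T) (hr : 0 < r) {ω ω' : Ω}
    (h : ∀ t, T ≤ t → F.c t ω < -r) (h' : ∀ t, T ≤ t → F.c t ω' < -r) :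
    F.X T ω = F.X T ω' ∧ F.Y T ω = F.Y T ω' := by
  set D : ℝ → ℝ := fun t => (F.X t ω - F.X t ω') ^ 2 + (F.Y t ω - F.Y t ω') ^ 2 with hD
  have hD0 : ∀ t, 0 ≤ D t := fun t => by positivity
  have hD4 : ∀ t, D t ≤ 4 := fun t => by
    have e1 := F.sq_add_sq t ω
    have e2 := F.sq_add_sq t ω'
    simp only [hD]
    nlinarith [sq_nonneg (F.X t ω + F.X t ω'), sq_nonneg (F.Y t ω + F.Y t ω')]
  have hd : ∀ t ∈ Ici T, HasDerivAt D (-(F.c t ω + F.c t ω') * D t) t := fun t ht =>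
    F.hasDerivAt_chord_sq (hT.trans_le ht) ω ω'
  -- In the repelling region `D' ≥ 2 r D`, so a nonzero chord would outgrow the diameter of the
  -- circle.
  have hgrow : ∀ t, T ≤ t → D T * Real.exp (2 * r * (t - T)) ≤ 4 := by
    intro t ht
    have := le_mul_exp_of_deriv_le_mul (f := fun t => -D t) (k := 2 * r) ht
      (fun r hr => (hd r hr).neg.continuousAt.continuousWithinAt)
      (fun r hr => (hd r (mem_Ioi.1 hr).le).neg)
      (fun t ht => by
        have h1 := h t (mem_Ioi.1 ht).le
        have h2 := h' t (mem_Ioi.1 ht).le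
        nlinarith [hD0 t])
    linarith [hD4 t]
  have hzero : D T = 0 := by
    by_contra hne
    have hpos : 0 < D T := lt_of_le_of_ne (hD0 T) (Ne.symm hne)
    have hlim : Tendsto (fun n : ℝ => D T * Real.exp (2 * r * ((T + n) - T))) atTop atTop := by
      simp only [add_sub_cancel_left]
      exact (Real.tendsto_exp_atTop.comp
        (tendsto_id.const_mul_atTop (by positivity))).const_mul_atTop hpos
    obtain ⟨n, hn, hn0⟩ := ((hlim.eventually_gt_atTop 4).and (eventually_ge_atTop 0)).exists
    linarith [hgrow (T + n) (by linarith)]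
  simp only [hD] at hzero
  constructor <;> nlinarith [sq_nonneg (F.X T ω - F.X T ω'), sq_nonneg (F.Y T ω - F.Y T ω')]

variable [IsProbabilityMeasure ν]

/-! ### Convergence of the mean field -/

theorem q_le_q {t₀ t : ℝ} (ht₀ : 0 < t₀) (h : t₀ ≤ t) : F.q t₀ ≤ F.q t :=
  F.monotoneOn_q ht₀ (ht₀.trans_le h) h

theorem integrableOn_P {t₀ : ℝ} (ht₀ : 0 < t₀) : IntegrableOn F.P (Ioi t₀) := by
  have h := integrableOn_Ioi_of_hasDerivAt_of_nonneg_of_le (g := F.q) (M := 1) (a := t₀)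
    (fun t ht => F.hasDerivAt_q (ht₀.trans_le ht)) (fun t _ => by linarith [F.P_nonneg t])
    (fun t _ => F.q_le_one t)
  have h' := h.const_mul (1 / 2)
  simp only [one_div, inv_mul_cancel_left₀ (two_ne_zero' ℝ)] at h'
  exact h'

/-- Dominated by `2 P`. Measurability in time is read off from the equation for `K`, where this term
equals `K' - K`. -/
theorem integrableOn_integral_s_cube {t₀ : ℝ} (ht₀ : 0 < t₀) (hq : 0 < F.q t₀) :
    IntegrableOn (fun t => 2 * ∫ ω, F.s t ω ^ 3 ∂ν) (Ioi t₀) := by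
  have hK : ContinuousOn F.K (Ioi t₀) := fun t ht =>
    (F.hasDerivAt_K (ht₀.trans ht) (hq.trans_le (F.q_le_q ht₀
      (mem_Ioi.1 ht).le))).continuousAt.continuousWithinAt
  refine Integrable.mono' ((F.integrableOn_P ht₀).const_mul 2) ?_
    ((ae_restrict_iff' measurableSet_Ioi).2 (Eventually.of_forall fun t _ => ?_))
  · refine ((aestronglyMeasurable_deriv F.K _).sub
      (hK.aestronglyMeasurable measurableSet_Ioi)).congr
      ((ae_restrict_iff' measurableSet_Ioi).2 (Eventually.of_forall fun t ht => ?_))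
    simp only [Pi.sub_apply]
    rw [(F.hasDerivAt_K (ht₀.trans ht) (hq.trans_le (F.q_le_q ht₀ (mem_Ioi.1 ht).le))).deriv]
    ring
  · rw [Real.norm_eq_abs, abs_mul, abs_two]
    linarith [F.abs_integral_s_cube_le t]

theorem integrableOn_K {t₀ : ℝ} (ht₀ : 0 < t₀) (hq : 0 < F.q t₀) :
    IntegrableOn F.K (Ioi t₀) :=
  integrableOn_Ioi_of_hasDerivAt_self_add (M := 1)
    (fun _ ht => F.hasDerivAt_K (ht₀.trans_le ht) (hq.trans_le (F.q_le_q ht₀ ht)))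
    (fun t _ => F.abs_K_le t) (F.integrableOn_integral_s_cube ht₀ hq)

theorem tendsto_K {t₀ : ℝ} (ht₀ : 0 < t₀) (hq : 0 < F.q t₀) : Tendsto F.K atTop (𝓝 0) :=
  tendsto_zero_of_hasDerivAt_of_integrableOn_Ioi (a := t₀)
    (fun _ ht => F.hasDerivAt_K (ht₀.trans ht) (hq.trans_le (F.q_le_q ht₀ (mem_Ioi.1 ht).le)))
    ((F.integrableOn_K ht₀ hq).add (F.integrableOn_integral_s_cube ht₀ hq))
    (F.integrableOn_K ht₀ hq)

/-- An integrable function with integrable derivative tends to zero; integrability of `P'` rests on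
that of `K`. -/
theorem tendsto_P {t₀ : ℝ} (ht₀ : 0 < t₀) (hq : 0 < F.q t₀) : Tendsto F.P atTop (𝓝 0) := by
  refine tendsto_zero_of_hasDerivAt_of_integrableOn_Ioi (a := t₀)
    (fun _ ht => F.hasDerivAt_P (ht₀.trans ht)) ?_ (F.integrableOn_P ht₀)
  refine integrableOn_of_hasDerivAt_of_le (fun _ ht => F.hasDerivAt_P (ht₀.trans ht))
    (((F.integrableOn_P ht₀).const_mul (2 / F.q t₀ + 2)).add
      ((F.integrableOn_K ht₀ hq).abs.const_mul (2 / F.q t₀))) fun t ht => ?_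
  have hqt := F.q_le_q ht₀ (mem_Ioi.1 ht).le
  refine (F.abs_integral_s_mul_sDot_le (hq.trans_le hqt)).trans ?_
  have hdiv : 2 / F.q t ≤ 2 / F.q t₀ := div_le_div_of_nonneg_left zero_le_two hq hqt
  exact add_le_add (mul_le_mul_of_nonneg_right (by linarith) (F.P_nonneg t))
    (mul_le_mul_of_nonneg_right hdiv (abs_nonneg _))

/-- A common bound for `a'`, `b'` and the mean-field part of `c'`, integrable in time and tending to
zero. -/
theorem div_q_le {t₀ t u v : ℝ} (ht₀ : 0 < t₀) (hq : 0 < F.q t₀) (ht : t₀ ≤ t)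
    (hu : |u| ≤ 1) (hv : |v| ≤ 1) :
    |(u * F.P t + v * F.K t) / F.q t| ≤ 1 / F.q t₀ * (F.P t + |F.K t|) := by
  have hqt := F.q_le_q ht₀ ht
  rw [abs_div, abs_of_pos (hq.trans_le hqt), div_eq_mul_one_div, mul_comm]
  have h1 : |u * F.P t + v * F.K t| ≤ F.P t + |F.K t| := by
    refine (abs_add_le _ _).trans ?_
    rw [abs_mul, abs_mul, abs_of_nonneg (F.P_nonneg t)]
    exact add_le_add (mul_le_of_le_one_left (F.P_nonneg t) hu)
      (mul_le_of_le_one_left (abs_nonneg _) hv)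
  exact mul_le_mul (one_div_le_one_div_of_le hq hqt) h1 (abs_nonneg _) (by positivity)

/-- The mean field converges. -/
theorem exists_tendsto_mean {t₀ : ℝ} (ht₀ : 0 < t₀) (hq : 0 < F.q t₀) :
    ∃ α β : ℝ, Tendsto F.a atTop (𝓝 α) ∧ Tendsto F.b atTop (𝓝 β) := by
  have hI : IntegrableOn (fun t => 1 / F.q t₀ * (F.P t + |F.K t|)) (Ioi t₀) :=
    ((F.integrableOn_P ht₀).add (F.integrableOn_K ht₀ hq).abs).const_mul _
  have ha : ∀ t ∈ Ioi t₀, HasDerivAt F.a ((F.a t * F.P t + F.b t * F.K t) / F.q t) t :=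
    fun t ht => F.hasDerivAt_a (ht₀.trans ht) (hq.trans_le (F.q_le_q ht₀ (mem_Ioi.1 ht).le))
  have hb : ∀ t ∈ Ioi t₀, HasDerivAt F.b ((F.b t * F.P t - F.a t * F.K t) / F.q t) t :=
    fun t ht => F.hasDerivAt_b (ht₀.trans ht) (hq.trans_le (F.q_le_q ht₀ (mem_Ioi.1 ht).le))
  refine ⟨_, _, tendsto_limUnder_of_hasDerivAt_of_integrableOn_Ioi ha
      (integrableOn_of_hasDerivAt_of_le ha hI fun t ht => ?_),
    tendsto_limUnder_of_hasDerivAt_of_integrableOn_Ioi hb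
      (integrableOn_of_hasDerivAt_of_le hb hI fun t ht => ?_)⟩
  · exact F.div_q_le ht₀ hq (mem_Ioi.1 ht).le (F.abs_a_le t) (F.abs_b_le t)
  · have h := F.div_q_le ht₀ hq (mem_Ioi.1 ht).le (F.abs_b_le t) (v := -F.a t)
      (by rw [abs_neg]; exact F.abs_a_le t)
    rwa [neg_mul, ← sub_eq_add_neg] at h

/-! ### Complete synchronization -/

/-- Eventually, no trajectory enters the repelling region `c < -R₀/2`. -/
theorem exists_forward_invariant {t₀ : ℝ} (ht₀ : 0 < t₀) (hq : 0 < F.q t₀) :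
    ∃ T, t₀ ≤ T ∧ ∀ t t' ω, T ≤ t → t ≤ t' → -(√(F.q t₀) / 2) ≤ F.c t ω →
      -(√(F.q t₀) / 2) ≤ F.c t' ω := by
  set r := √(F.q t₀) / 2 with hr
  have hr2 : r ^ 2 = F.q t₀ / 4 := by rw [hr, div_pow, Real.sq_sqrt hq.le]; norm_num
  have hlim : Tendsto (fun t => 1 / F.q t₀ * (F.P t + |F.K t|)) atTop (𝓝 0) := by
    simpa using ((F.tendsto_P ht₀ hq).add (F.tendsto_K ht₀ hq).abs).const_mul (1 / F.q t₀)
  obtain ⟨T, hT⟩ := eventually_atTop.1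
    (hlim.eventually (gt_mem_nhds (show (0 : ℝ) < F.q t₀ / 4 by positivity)))
  refine ⟨max T t₀, le_max_right _ _, fun t t' ω hTt htle hc => ?_⟩
  have ht : t₀ ≤ t := (le_max_right _ _).trans hTt
  have hd : ∀ u, t ≤ u → HasDerivAt (fun u => -F.c u ω) (-F.cDot u ω) u := fun u hu =>
    (F.hasDerivAt_c (ht₀.trans_le (ht.trans hu)) ω).neg
  -- Barrier argument: where `c = -r`, `s² = q - r² ≥ 3 q(t₀)/4`, while the rest of `c'` is below
  -- `q(t₀)/4` in size after `T`. So `c' > 0` there and the level is not crossed downwards.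
  have := image_le_of_deriv_right_lt_deriv_boundary (a := t) (b := t') (f := fun u => -F.c u ω)
    (B := fun _ => r) (B' := fun _ => 0)
    (fun u hu => (hd u hu.1).continuousAt.continuousWithinAt)
    (fun u hu => (hd u hu.1).hasDerivWithinAt) (by linarith) (fun _ => hasDerivAt_const _ _)
    (fun u hu he => by
      have hu0 : t₀ ≤ u := ht.trans hu.1
      have hqu := F.q_le_q ht₀ hu0
      have hb := F.div_q_le ht₀ hq hu0 (F.abs_c_le u ω) (v := -F.s u ω)
        (by rw [abs_neg]; exact F.abs_s_le u ω)
      have hsmall := hT u (((le_max_left _ _).trans hTt).trans hu.1)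
      have hs := F.s_sq_add_c_sq u ω
      have hcr : F.c u ω ^ 2 = r ^ 2 := by
        rw [← he]; ring
      have hb' := (abs_le.1 hb).1
      rw [F.cDot_eq (hq.trans_le hqu)]
      rw [show F.P u * F.c u ω - F.K u * F.s u ω
        = F.c u ω * F.P u + -F.s u ω * F.K u by ring]
      linarith)
  linarith [this (right_mem_Icc.2 htle)]

/-- Without atoms, the order parameter converges to `1`. -/
theorem limit_q_eq_one {t₀ : ℝ} (ht₀ : 0 < t₀) (hq : 0 < F.q t₀)
    (hinj : ∀ t, 0 < t → ∀ ω ω', F.X t ω = F.X t ω' → F.Y t ω = F.Y t ω' → ω = ω')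
    (hatom : ∀ ω, ν {ω} = 0) {L : ℝ} (hL : Tendsto F.q atTop (𝓝 L)) : L = 1 := by
  obtain ⟨T, hTt₀, hinv⟩ := F.exists_forward_invariant ht₀ hq
  set R₀ := √(F.q t₀) with hR₀
  have hR₀pos : 0 < R₀ := Real.sqrt_pos.2 hq
  set G : ℕ → Set Ω := fun n => {ω | -(R₀ / 2) ≤ F.c (T + n) ω} with hG
  have hGm : ∀ n, MeasurableSet (G n) := fun n => measurableSet_le measurable_const
    (F.measurable_c _)
  have hGmono : Monotone G := fun m n hmn ω hω =>
    hinv (T + m) (T + n) ω (by linarith [Nat.cast_nonneg (α := ℝ) m])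
      (by have : (m : ℝ) ≤ n := Nat.cast_le.2 hmn
          linarith) hω
  -- Outside all `G n`, a trajectory stays in the repelling region from `T` on; two such
  -- trajectories coincide at `T`, hence initially.
  have hB : (⋃ n, G n)ᶜ.Subsingleton := by
    have hlt : ∀ ω ∈ (⋃ n, G n)ᶜ, ∀ t, T ≤ t → F.c t ω < -(R₀ / 2) := by
      intro ω hω t ht
      by_contra hcon
      obtain ⟨n, hn⟩ := exists_nat_ge (t - T)
      exact hω (mem_iUnion.2 ⟨n, hinv t (T + n) ω ht (by linarith) (not_lt.1 hcon)⟩)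
    intro ω hω ω' hω'
    have h := F.eq_of_forall_c_lt (ht₀.trans_le hTt₀) (half_pos hR₀pos) (hlt ω hω) (hlt ω' hω')
    exact hinj T (ht₀.trans_le hTt₀) ω ω' h.1 h.2
  have hB0 : ν (⋃ n, G n)ᶜ = 0 := by
    rcases hB.eq_empty_or_singleton with h | ⟨ω, h⟩
    · rw [h, measure_empty]
    · rw [h, hatom]
  have hGlim : Tendsto (fun n => ν.real (G n)) atTop (𝓝 1) := by
    have h := tendsto_measure_iUnion_atTop (μ := ν) hGmono
    have h1 : ν (⋃ n, G n) = 1 :=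
      (prob_compl_eq_zero_iff (MeasurableSet.iUnion hGm)).1 hB0
    rw [h1] at h
    exact (ENNReal.tendsto_toReal ENNReal.one_ne_top).comp h
  -- Integrate `R - c`. On `G n`, `s² = (R - c)(R + c)` with `R + c ≥ R₀/2`; off `G n`, `R - c ≤ 2`.
  -- In the limit `√L ≤ L`, which with `L > 0` forces `L ≥ 1`.
  have hbound : ∀ n : ℕ, √(F.q (T + n)) - F.q (T + n) ≤
      2 / R₀ * F.P (T + n) + 2 * (1 - ν.real (G n)) := by
    intro n
    set t := T + (n : ℝ) with ht
    have hqt : F.q t₀ ≤ F.q t := F.q_le_q ht₀ (by linarith [Nat.cast_nonneg (α := ℝ) n])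
    set R := √(F.q t) with hR
    have hRR : R₀ ≤ R := Real.sqrt_le_sqrt hqt
    have hR1 : R ≤ 1 := Real.sqrt_le_one.2 (F.q_le_one t)
    have hRsq : R ^ 2 = F.q t := Real.sq_sqrt (F.q_nonneg t)
    have hind : Integrable ((G n)ᶜ.indicator fun _ => (2 : ℝ)) ν :=
      (integrable_const _).indicator (hGm n).compl
    have hle : ∫ ω, (R - F.c t ω) ∂ν ≤
        ∫ ω, (2 / R₀ * F.s t ω ^ 2 + (G n)ᶜ.indicator (fun _ => (2 : ℝ)) ω) ∂ν := by
      refine integral_mono ((integrable_const _).sub (F.integrable_c t))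
        (((F.integrable_s_sq t).const_mul _).add hind) fun ω => ?_
      have hsc := F.s_sq_add_c_sq t ω
      by_cases hω : ω ∈ G n
      · have hc : -(R₀ / 2) ≤ F.c t ω := hω
        simp only [indicator_of_notMem (notMem_compl_iff.2 hω), add_zero]
        rw [div_mul_eq_mul_div, le_div_iff₀ hR₀pos]
        have hcR : F.c t ω ≤ R := Real.le_sqrt_of_sq_le (by nlinarith [sq_nonneg (F.s t ω)])
        nlinarith
      · simp only [indicator_of_mem (mem_compl hω)]
        have := (abs_le.1 (F.abs_c_le t ω)).1
        have : 0 ≤ 2 / R₀ * F.s t ω ^ 2 := by positivity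
        linarith
    rw [integral_sub (integrable_const _) (F.integrable_c t), F.integral_c,
      integral_add ((F.integrable_s_sq t).const_mul _) hind, integral_const_mul,
      integral_indicator (hGm n).compl] at hle
    simp only [integral_const, smul_eq_mul, probReal_univ, one_mul,
      measureReal_restrict_apply_univ, probReal_compl_eq_one_sub (hGm n)] at hle
    change R - F.q t ≤ 2 / R₀ * F.P t + _ at hle
    linarith
  have hseq : Tendsto (fun n : ℕ => T + (n : ℝ)) atTop atTop :=
    tendsto_atTop_add_const_left _ _ tendsto_natCast_atTop_atTop
  have hlim1 : Tendsto (fun n : ℕ => √(F.q (T + n)) - F.q (T + n)) atTop (𝓝 (√L - L)) :=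
    (hL.comp hseq).sqrt.sub (hL.comp hseq)
  have hlim2 : Tendsto (fun n : ℕ => 2 / R₀ * F.P (T + n) + 2 * (1 - ν.real (G n))) atTop
      (𝓝 0) := by
    simpa using (((F.tendsto_P ht₀ hq).comp hseq).const_mul (2 / R₀)).add
      ((hGlim.const_sub 1).const_mul 2)
  have hfin : √L - L ≤ 0 := le_of_tendsto_of_tendsto' hlim1 hlim2 hbound
  have hLpos : 0 < L := hq.trans_le (ge_of_tendsto hL (by
    filter_upwards [eventually_ge_atTop t₀] with t ht using F.q_le_q ht₀ ht))
  have hL1 : L ≤ 1 := le_of_tendsto' hL F.q_le_one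
  have hs : √L ^ 2 = L := Real.sq_sqrt hLpos.le
  have hsp : 0 < √L := Real.sqrt_pos.2 hLpos
  have : 1 ≤ √L := by
    by_contra hlt
    nlinarith
  nlinarith

end CircleFlow

/-! ### The velocity field and its characteristics -/

theorem sin_sub_angle (θ ψ : Phase) : (θ - ψ).sin = θ.sin * ψ.cos - θ.cos * ψ.sin := by
  rw [sub_eq_add_neg, Real.Angle.sin_add, Real.Angle.sin_neg, Real.Angle.cos_neg]
  ring

theorem cos_sub_angle (θ ψ : Phase) : (θ - ψ).cos = θ.cos * ψ.cos + θ.sin * ψ.sin := by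
  rw [sub_eq_add_neg, Real.Angle.cos_add, Real.Angle.sin_neg, Real.Angle.cos_neg]
  ring

theorem abs_cos_angle_le (θ : Phase) : |θ.cos| ≤ 1 :=
  abs_le_one_iff_mul_self_le_one.2 (by nlinarith [Real.Angle.cos_sq_add_sin_sq θ])

theorem abs_sin_angle_le (θ : Phase) : |θ.sin| ≤ 1 :=
  abs_le_one_iff_mul_self_le_one.2 (by nlinarith [Real.Angle.cos_sq_add_sin_sq θ])

theorem integrable_cos (μ : ProbabilityMeasure Phase) :
    Integrable (fun θ : Phase => θ.cos) (μ : Measure Phase) :=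
  Integrable.of_bound Real.Angle.continuous_cos.aestronglyMeasurable 1
    (Eventually.of_forall abs_cos_angle_le)

theorem integrable_sin (μ : ProbabilityMeasure Phase) :
    Integrable (fun θ : Phase => θ.sin) (μ : Measure Phase) :=
  Integrable.of_bound Real.Angle.continuous_sin.aestronglyMeasurable 1
    (Eventually.of_forall abs_sin_angle_le)

/-- The mean of the cosine. -/
noncomputable def meanCos (μ : ProbabilityMeasure Phase) : ℝ :=
  ∫ θ : Phase, θ.cos ∂(μ : Measure Phase)

/-- The mean of the sine. -/
noncomputable def meanSin (μ : ProbabilityMeasure Phase) : ℝ :=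
  ∫ θ : Phase, θ.sin ∂(μ : Measure Phase)

theorem abs_meanCos_le (μ : ProbabilityMeasure Phase) : |meanCos μ| ≤ 1 :=
  CircleFlow.abs_integral_le_of_abs_le abs_cos_angle_le

theorem abs_meanSin_le (μ : ProbabilityMeasure Phase) : |meanSin μ| ≤ 1 :=
  CircleFlow.abs_integral_le_of_abs_le abs_sin_angle_le

theorem velocity_eq_mean (μ : ProbabilityMeasure Phase) (θ : Phase) :
    velocity μ θ = -(meanCos μ * θ.sin - meanSin μ * θ.cos) := by
  rw [velocity_eq_integral]
  simp_rw [sin_sub_angle]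
  rw [integral_sub ((integrable_cos μ).const_mul _) ((integrable_sin μ).const_mul _),
    integral_const_mul, integral_const_mul]
  simp only [meanCos, meanSin]
  ring

namespace IsCharacteristic

variable {ρ : ℝ → ProbabilityMeasure Phase} {x x' : ℝ → Phase}

theorem continuousOn_cos (h : IsCharacteristic ρ x) :
    ContinuousOn (fun t => (x t).cos) (Ici 0) := by
  obtain ⟨y, hy⟩ := h
  refine ContinuousOn.congr (f := fun t => Real.cos (y t))
    (Real.continuous_cos.comp_continuousOn fun t ht => (hy t ht).2.continuousWithinAt) fun t ht => ?_
  rw [← (hy t ht).1, Real.Angle.cos_coe]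

theorem continuousOn_sin (h : IsCharacteristic ρ x) :
    ContinuousOn (fun t => (x t).sin) (Ici 0) := by
  obtain ⟨y, hy⟩ := h
  refine ContinuousOn.congr (f := fun t => Real.sin (y t))
    (Real.continuous_sin.comp_continuousOn fun t ht => (hy t ht).2.continuousWithinAt) fun t ht => ?_
  rw [← (hy t ht).1, Real.Angle.sin_coe]

theorem hasDerivAt_cos (h : IsCharacteristic ρ x) {t : ℝ} (ht : 0 < t) :
    HasDerivAt (fun r => (x r).cos)
      ((meanCos (ρ t) * (x t).sin - meanSin (ρ t) * (x t).cos) * (x t).sin) t := by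
  obtain ⟨y, hy⟩ := h
  have hd := ((hy t ht.le).2.hasDerivAt (Ici_mem_nhds ht)).cos
  refine (hd.congr_of_eventuallyEq ?_).congr_deriv ?_
  · filter_upwards [Ioi_mem_nhds ht] with r hr
    rw [← (hy r (mem_Ioi.1 hr).le).1, Real.Angle.cos_coe]
  · rw [velocity_eq_mean, ← (hy t ht.le).1, Real.Angle.sin_coe]
    ring

theorem hasDerivAt_sin (h : IsCharacteristic ρ x) {t : ℝ} (ht : 0 < t) :
    HasDerivAt (fun r => (x r).sin)
      (-(meanCos (ρ t) * (x t).sin - meanSin (ρ t) * (x t).cos) * (x t).cos) t := by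
  obtain ⟨y, hy⟩ := h
  have hd := ((hy t ht.le).2.hasDerivAt (Ici_mem_nhds ht)).sin
  refine (hd.congr_of_eventuallyEq ?_).congr_deriv ?_
  · filter_upwards [Ioi_mem_nhds ht] with r hr
    rw [← (hy r (mem_Ioi.1 hr).le).1, Real.Angle.sin_coe]
  · rw [velocity_eq_mean, ← (hy t ht.le).1, Real.Angle.cos_coe]
    ring

end IsCharacteristic

/-! ### Chords between characteristics -/

/-- The squared chord between two phases. -/
noncomputable def chordSq (θ ψ : Phase) : ℝ := (θ.cos - ψ.cos) ^ 2 + (θ.sin - ψ.sin) ^ 2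

theorem chordSq_nonneg (θ ψ : Phase) : 0 ≤ chordSq θ ψ := by unfold chordSq; positivity

theorem eq_of_cos_eq_of_sin_eq {θ ψ : Phase} (hc : θ.cos = ψ.cos) (hs : θ.sin = ψ.sin) :
    θ = ψ := by
  induction θ using Real.Angle.induction_on with
  | _ θ =>
    induction ψ using Real.Angle.induction_on with
    | _ ψ => exact Real.Angle.cos_sin_inj (by simpa using hc) (by simpa using hs)

theorem eq_of_chordSq_nonpos {θ ψ : Phase} (h : chordSq θ ψ ≤ 0) : θ = ψ := by
  unfold chordSq at h
  exact eq_of_cos_eq_of_sin_eq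
    (by nlinarith [sq_nonneg (θ.cos - ψ.cos), sq_nonneg (θ.sin - ψ.sin)])
    (by nlinarith [sq_nonneg (θ.cos - ψ.cos), sq_nonneg (θ.sin - ψ.sin)])

/-- The logarithmic derivative of the squared chord is bounded by `4`. As no regularity of the flow
in the initial phase is assumed, the upper bound supplies its continuity and the lower bound its
injectivity. -/
theorem IsCharacteristic.chordSq_le {ρ : ℝ → ProbabilityMeasure Phase} {x x' : ℝ → Phase}
    (h : IsCharacteristic ρ x) (h' : IsCharacteristic ρ x') {t : ℝ} (ht : 0 ≤ t) :
    chordSq (x t) (x' t) ≤ chordSq (x 0) (x' 0) * Real.exp (4 * t) ∧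
      chordSq (x 0) (x' 0) * Real.exp (-4 * t) ≤ chordSq (x t) (x' t) := by
  have hd : ∀ r ∈ Ioi (0 : ℝ), HasDerivAt (fun r => chordSq (x r) (x' r))
      (-((meanCos (ρ r) * (x r).cos + meanSin (ρ r) * (x r).sin)
        + (meanCos (ρ r) * (x' r).cos + meanSin (ρ r) * (x' r).sin)) * chordSq (x r) (x' r)) r :=
    fun r hr => hasDerivAt_chord_sq (Real.Angle.cos_sq_add_sin_sq _)
      (Real.Angle.cos_sq_add_sin_sq _) (h.hasDerivAt_cos hr) (h.hasDerivAt_sin hr)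
      (h'.hasDerivAt_cos hr) (h'.hasDerivAt_sin hr)
  have hc : ContinuousOn (fun r => chordSq (x r) (x' r)) (Ici 0) :=
    ((h.continuousOn_cos.sub h'.continuousOn_cos).pow 2).add
      ((h.continuousOn_sin.sub h'.continuousOn_sin).pow 2)
  have hb : ∀ (r : ℝ) (θ : Phase),
      |meanCos (ρ r) * θ.cos + meanSin (ρ r) * θ.sin| ≤ 2 := by
    intro r θ
    refine (abs_add_le _ _).trans ?_
    rw [abs_mul, abs_mul]
    linarith [mul_le_one₀ (abs_meanCos_le (ρ r)) (abs_nonneg _) (abs_cos_angle_le θ),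
      mul_le_one₀ (abs_meanSin_le (ρ r)) (abs_nonneg _) (abs_sin_angle_le θ)]
  constructor
  · have := le_mul_exp_of_deriv_le_mul (k := 4) ht hc hd (fun r _ => by
      refine mul_le_mul_of_nonneg_right ?_ (chordSq_nonneg _ _)
      linarith [(abs_le.1 (hb r (x r))).1, (abs_le.1 (hb r (x' r))).1])
    simpa using this
  · have := le_mul_exp_of_deriv_le_mul (k := -4) ht hc.neg (fun r hr => (hd r hr).neg)
      (fun r _ => by
        simp only [Pi.neg_apply]
        nlinarith [(abs_le.1 (hb r (x r))).2, (abs_le.1 (hb r (x' r))).2,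
          chordSq_nonneg (x r) (x' r)])
    simp only [Pi.neg_apply, sub_zero] at this
    linarith

/-- A function on the torus whose increments are controlled by chords is continuous. -/
theorem continuous_of_sq_sub_le_chordSq {f : Phase → ℝ} {C : ℝ}
    (hf : ∀ θ ψ, (f θ - f ψ) ^ 2 ≤ chordSq θ ψ * C) : Continuous f := by
  refine continuous_iff_continuousAt.2 fun ψ => ?_
  have hlim : Tendsto (fun θ => √(chordSq θ ψ * C)) (𝓝 ψ) (𝓝 0) := by
    have hcont : Continuous fun θ : Phase => √(chordSq θ ψ * C) := by
      unfold chordSq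
      have := Real.Angle.continuous_cos
      have := Real.Angle.continuous_sin
      fun_prop
    simpa [chordSq] using hcont.tendsto ψ
  refine tendsto_iff_dist_tendsto_zero.2 (squeeze_zero (fun _ => dist_nonneg) (fun θ => ?_) hlim)
  rw [Real.dist_eq]
  exact Real.abs_le_sqrt (hf θ ψ)

/-! ### The flow of a solution as a circle flow -/

section Flow

variable {ρ : ℝ → ProbabilityMeasure Phase} {Θ : ℝ → Phase → Phase}

theorem continuous_cos_flow (h0 : ∀ θ, Θ 0 θ = θ)
    (hchar : ∀ θ, IsCharacteristic ρ fun t => Θ t θ) {t : ℝ} (ht : 0 ≤ t) :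
    Continuous fun θ => (Θ t θ).cos :=
  continuous_of_sq_sub_le_chordSq (C := Real.exp (4 * t)) fun θ ψ => by
    have h := ((hchar θ).chordSq_le (hchar ψ) ht).1
    simp only [h0] at h
    refine le_trans ?_ h
    unfold chordSq
    nlinarith [sq_nonneg ((Θ t θ).sin - (Θ t ψ).sin)]

theorem continuous_sin_flow (h0 : ∀ θ, Θ 0 θ = θ)
    (hchar : ∀ θ, IsCharacteristic ρ fun t => Θ t θ) {t : ℝ} (ht : 0 ≤ t) :
    Continuous fun θ => (Θ t θ).sin :=
  continuous_of_sq_sub_le_chordSq (C := Real.exp (4 * t)) fun θ ψ => by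
    have h := ((hchar θ).chordSq_le (hchar ψ) ht).1
    simp only [h0] at h
    refine le_trans ?_ h
    unfold chordSq
    nlinarith [sq_nonneg ((Θ t θ).cos - (Θ t ψ).cos)]

/-- The flow of a measure-valued solution, seen on the unit circle. -/
noncomputable def circleFlow (h0 : ∀ θ, Θ 0 θ = θ)
    (hchar : ∀ θ, IsCharacteristic ρ fun t => Θ t θ)
    (htrans : ∀ t : ℝ, 0 ≤ t → ∀ h : C(Phase, ℝ),
      ∫ θ, h θ ∂(ρ t : Measure Phase) = ∫ θ, h (Θ t θ) ∂(ρ 0 : Measure Phase)) :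
    CircleFlow (ρ 0 : Measure Phase) where
  -- Measurability is required at every real time, but nothing is known of `Θ` at negative times;
  -- `max t 0` freezes the flow there.
  X t θ := (Θ (max t 0) θ).cos
  Y t θ := (Θ (max t 0) θ).sin
  sq_add_sq t θ := Real.Angle.cos_sq_add_sin_sq _
  measurable_X t := (continuous_cos_flow h0 hchar (le_max_right t 0)).measurable
  measurable_Y t := (continuous_sin_flow h0 hchar (le_max_right t 0)).measurable
  hasDerivAt_X' t ht θ := by
    have hc := htrans t ht.le ⟨_, Real.Angle.continuous_cos⟩
    have hs := htrans t ht.le ⟨_, Real.Angle.continuous_sin⟩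
    simp only [ContinuousMap.coe_mk] at hc hs
    rw [max_eq_left ht.le, ← hc, ← hs]
    refine ((hchar θ).hasDerivAt_cos ht).congr_of_eventuallyEq ?_
    filter_upwards [Ioi_mem_nhds ht] with r hr
    rw [max_eq_left (mem_Ioi.1 hr).le]
  hasDerivAt_Y' t ht θ := by
    have hc := htrans t ht.le ⟨_, Real.Angle.continuous_cos⟩
    have hs := htrans t ht.le ⟨_, Real.Angle.continuous_sin⟩
    simp only [ContinuousMap.coe_mk] at hc hs
    rw [max_eq_left ht.le, ← hc, ← hs]
    refine ((hchar θ).hasDerivAt_sin ht).congr_of_eventuallyEq ?_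
    filter_upwards [Ioi_mem_nhds ht] with r hr
    rw [max_eq_left (mem_Ioi.1 hr).le]

variable (h0 : ∀ θ, Θ 0 θ = θ) (hchar : ∀ θ, IsCharacteristic ρ fun t => Θ t θ)
  (htrans : ∀ t : ℝ, 0 ≤ t → ∀ h : C(Phase, ℝ),
      ∫ θ, h θ ∂(ρ t : Measure Phase) = ∫ θ, h (Θ t θ) ∂(ρ 0 : Measure Phase))

theorem circleFlow_a {t : ℝ} (ht : 0 ≤ t) :
    (circleFlow h0 hchar htrans).a t = meanCos (ρ t) := by
  have hc := htrans t ht ⟨_, Real.Angle.continuous_cos⟩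
  simp only [ContinuousMap.coe_mk] at hc
  simp only [CircleFlow.a, circleFlow, max_eq_left ht, meanCos, hc]

theorem circleFlow_b {t : ℝ} (ht : 0 ≤ t) :
    (circleFlow h0 hchar htrans).b t = meanSin (ρ t) := by
  have hs := htrans t ht ⟨_, Real.Angle.continuous_sin⟩
  simp only [ContinuousMap.coe_mk] at hs
  simp only [CircleFlow.b, circleFlow, max_eq_left ht, meanSin, hs]

theorem circleFlow_P {t : ℝ} (ht : 0 ≤ t) :
    (circleFlow h0 hchar htrans).P t =
      ∫ θ : Phase, (meanCos (ρ t) * θ.sin - meanSin (ρ t) * θ.cos) ^ 2 ∂(ρ t : Measure Phase) := by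
  have hcont : Continuous fun θ : Phase =>
      (meanCos (ρ t) * θ.sin - meanSin (ρ t) * θ.cos) ^ 2 := by
    have := Real.Angle.continuous_cos
    have := Real.Angle.continuous_sin
    fun_prop
  have h := htrans t ht ⟨_, hcont⟩
  simp only [ContinuousMap.coe_mk] at h
  rw [h]
  simp only [CircleFlow.P, CircleFlow.s, circleFlow_a h0 hchar htrans ht,
    circleFlow_b h0 hchar htrans ht]
  simp only [circleFlow, max_eq_left ht]

/-- If the mean field vanishes, the solution is stationary. -/
theorem isStationary_of_q_eq_zero
    (hq : ∀ t, 0 < t → (circleFlow h0 hchar htrans).q t = 0) : IsStationary ρ := by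
  intro t ht
  have hfix : ∀ θ, Θ t θ = θ := by
    intro θ
    obtain ⟨y, hy⟩ := hchar θ
    have hd : ∀ r ∈ Ioi (0 : ℝ), HasDerivAt y 0 r := by
      intro r hr
      have h := (hy r (mem_Ioi.1 hr).le).2.hasDerivAt (Ici_mem_nhds hr)
      have hqr := hq r hr
      simp only [CircleFlow.q, circleFlow_a h0 hchar htrans (mem_Ioi.1 hr).le,
        circleFlow_b h0 hchar htrans (mem_Ioi.1 hr).le] at hqr
      have e1 : meanCos (ρ r) = 0 := by
        nlinarith [sq_nonneg (meanCos (ρ r)), sq_nonneg (meanSin (ρ r))]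
      have e2 : meanSin (ρ r) = 0 := by
        nlinarith [sq_nonneg (meanCos (ρ r)), sq_nonneg (meanSin (ρ r))]
      rw [velocity_eq_mean, e1, e2] at h
      simpa using h
    have hc : ContinuousOn y (Ici 0) := fun r hr => (hy r hr).2.continuousWithinAt
    -- Rate `0`, for `y` and then `-y`, gives constancy up to the endpoint `0`.
    have h1 := le_mul_exp_of_deriv_le_mul (k := 0) ht hc hd (fun r _ => by simp)
    have h2 := le_mul_exp_of_deriv_le_mul (k := 0) ht hc.neg (fun r hr => (hd r hr).neg)
      (fun r _ => by simp)
    simp only [zero_mul, Real.exp_zero, mul_one, Pi.neg_apply] at h1 h2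
    have hyt : y t = y 0 := le_antisymm h1 (by linarith)
    have e := (hy t ht).1
    rw [hyt, (hy 0 le_rfl).1] at e
    exact e.symm.trans (h0 θ)
  have : IsFiniteMeasure (ρ t : Measure Phase) := inferInstance
  refine Subtype.ext (ext_of_forall_integral_eq_of_IsFiniteMeasure
    (μ := (ρ t : Measure Phase)) (ν := (ρ 0 : Measure Phase)) fun f => ?_)
  have h := htrans t ht f.toContinuousMap
  simp only [hfix] at h
  exact h

end Flow

/-! ### Convergence to two antipodal point masses -/

instance instCompactSpacePhase : CompactSpace Phase :=
  haveI : Fact (0 < 2 * Real.pi) := ⟨Real.two_pi_pos⟩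
  inferInstanceAs (CompactSpace (AddCircle (2 * Real.pi)))

theorem eq_or_eq_add_pi_of_sin_sub_eq_zero {θ φ : Phase} (h : (θ - φ).sin = 0) :
    θ = φ ∨ θ = φ + (Real.pi : Phase) := by
  rcases Real.Angle.sin_eq_zero_iff.1 h with h | h
  · exact Or.inl (sub_eq_zero.1 h)
  · exact Or.inr (by rw [← h]; abel)

theorem continuous_sin_sub (φ : Phase) : Continuous fun θ : Phase => (θ - φ).sin :=
  Real.Angle.continuous_sin.comp (continuous_id.sub continuous_const)

theorem continuous_cos_sub (φ : Phase) : Continuous fun θ : Phase => (θ - φ).cos :=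
  Real.Angle.continuous_cos.comp (continuous_id.sub continuous_const)

/-- The compact set `|g| ≥ ε` avoids both zeros of `sin(θ - φ)`, so `sin²` has a positive minimum on
it. -/
theorem exists_abs_le_add_mul_sin_sq {g : Phase → ℝ} (hg : Continuous g) {φ : Phase}
    (h0 : g φ = 0) (hpi : g (φ + (Real.pi : Phase)) = 0) {ε : ℝ} (hε : 0 < ε) :
    ∃ C, 0 ≤ C ∧ ∀ θ, |g θ| ≤ ε + C * (θ - φ).sin ^ 2 := by
  set S : Set Phase := {θ | ε ≤ |g θ|} with hS
  have hcomp : IsCompact S := (isClosed_le continuous_const hg.abs).isCompact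
  rcases S.eq_empty_or_nonempty with hemp | hne
  · refine ⟨0, le_rfl, fun θ => ?_⟩
    have : θ ∉ S := by rw [hemp]; exact notMem_empty θ
    have : |g θ| < ε := not_le.1 this
    linarith
  · obtain ⟨θ₀, hθ₀, hmin⟩ := hcomp.exists_isMinOn hne ((continuous_sin_sub φ).pow 2).continuousOn
    obtain ⟨θ₁, -, hmax⟩ := hcomp.exists_isMaxOn hne hg.abs.continuousOn
    have hpos : 0 < (θ₀ - φ).sin ^ 2 := by
      refine lt_of_le_of_ne (sq_nonneg _) fun hz => ?_
      have hz' : (θ₀ - φ).sin = 0 := by simpa using hz.symm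
      have hgz : g θ₀ = 0 := by
        rcases eq_or_eq_add_pi_of_sin_sub_eq_zero hz' with h | h <;> rw [h] <;> assumption
      have : ε ≤ |g θ₀| := hθ₀
      rw [hgz, abs_zero] at this
      linarith
    refine ⟨|g θ₁| / (θ₀ - φ).sin ^ 2, by positivity, fun θ => ?_⟩
    by_cases hθ : θ ∈ S
    · have h1 : |g θ| ≤ |g θ₁| := hmax hθ
      have h2 : (θ₀ - φ).sin ^ 2 ≤ (θ - φ).sin ^ 2 := hmin hθ
      have h3 : |g θ₁| ≤ |g θ₁| / (θ₀ - φ).sin ^ 2 * (θ - φ).sin ^ 2 := by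
        rw [div_mul_eq_mul_div, le_div_iff₀ hpos]
        exact mul_le_mul_of_nonneg_left h2 (abs_nonneg _)
      linarith
    · have h1 : |g θ| < ε := not_le.1 hθ
      have : 0 ≤ |g θ₁| / (θ₀ - φ).sin ^ 2 * (θ - φ).sin ^ 2 := by positivity
      linarith

theorem integrable_of_continuous (μ : ProbabilityMeasure Phase) {f : Phase → ℝ}
    (hf : Continuous f) : Integrable f (μ : Measure Phase) := by
  obtain ⟨C, hC⟩ := isCompact_univ.exists_bound_of_continuousOn hf.continuousOn
  exact Integrable.of_bound hf.aestronglyMeasurable C (Eventually.of_forall fun θ => hC θ trivial)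

/-- Concentration on the line through `φ` together with convergence of the mean along it
determines the limit of all observables. -/
theorem tendsto_integral_of_tendsto_sin_sq {ι : Type*} {l : Filter ι}
    {μ : ι → ProbabilityMeasure Phase} {φ : Phase} {R : ℝ}
    (hsin : Tendsto (fun i => ∫ θ : Phase, (θ - φ).sin ^ 2 ∂(μ i : Measure Phase)) l (𝓝 0))
    (hcos : Tendsto (fun i => ∫ θ : Phase, (θ - φ).cos ∂(μ i : Measure Phase)) l (𝓝 R))
    {f : Phase → ℝ} (hf : Continuous f) :
    Tendsto (fun i => ∫ θ, f θ ∂(μ i : Measure Phase)) l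
      (𝓝 ((1 + R) / 2 * f φ + (1 - R) / 2 * f (φ + (Real.pi : Phase)))) := by
  -- `A + B cos(θ - φ)` interpolates `f` at `φ` and `φ + π`; the remainder `g` vanishes at both and
  -- is controlled by `sin²`.
  set A := (f φ + f (φ + (Real.pi : Phase))) / 2 with hA
  set B := (f φ - f (φ + (Real.pi : Phase))) / 2 with hB
  set g : Phase → ℝ := fun θ => f θ - (A + B * (θ - φ).cos) with hg
  have hgc : Continuous g :=
    hf.sub (continuous_const.add (continuous_const.mul (continuous_cos_sub φ)))
  have hg0 : g φ = 0 := by simp [hg, hA, hB]; ring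
  have hgpi : g (φ + (Real.pi : Phase)) = 0 := by simp [hg, hA, hB]; ring
  have hglim : Tendsto (fun i => ∫ θ, g θ ∂(μ i : Measure Phase)) l (𝓝 0) := by
    rw [Metric.tendsto_nhds]
    intro ε hε
    obtain ⟨C, hC0, hC⟩ := exists_abs_le_add_mul_sin_sq hgc hg0 hgpi (half_pos hε)
    have h1 : Tendsto (fun i => ε / 2 + C * ∫ θ : Phase, (θ - φ).sin ^ 2 ∂(μ i : Measure Phase)) l
        (𝓝 (ε / 2)) := by
      simpa using (hsin.const_mul C).const_add (ε / 2)
    filter_upwards [h1.eventually (gt_mem_nhds (half_lt_self hε))] with i hi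
    rw [dist_zero_right]
    refine lt_of_le_of_lt ?_ hi
    have hsI : Integrable (fun θ : Phase => C * (θ - φ).sin ^ 2) (μ i : Measure Phase) :=
      (integrable_of_continuous (μ i) ((continuous_sin_sub φ).pow 2)).const_mul C
    have hI : Integrable (fun θ : Phase => ε / 2 + C * (θ - φ).sin ^ 2) (μ i : Measure Phase) :=
      (integrable_const _).add hsI
    refine (norm_integral_le_of_norm_le hI (Eventually.of_forall hC)).trans (le_of_eq ?_)
    rw [integral_add (integrable_const _) hsI, integral_const_mul]
    simp
  have hsum : Tendsto (fun i => (∫ θ, g θ ∂(μ i : Measure Phase))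
      + (A + B * ∫ θ : Phase, (θ - φ).cos ∂(μ i : Measure Phase))) l (𝓝 (0 + (A + B * R))) :=
    hglim.add ((hcos.const_mul B).const_add A)
  have hval : (1 + R) / 2 * f φ + (1 - R) / 2 * f (φ + (Real.pi : Phase)) = 0 + (A + B * R) := by
    rw [hA, hB]; ring
  rw [hval]
  refine hsum.congr fun i => ?_
  have hcI := (integrable_of_continuous (μ i) (continuous_cos_sub φ)).const_mul B
  have hI : Integrable (fun θ : Phase => A + B * (θ - φ).cos) (μ i : Measure Phase) :=
    (integrable_const _).add hcI
  simp only [hg]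
  rw [integral_sub (integrable_of_continuous (μ i) hf) hI,
    integral_add (integrable_const _) hcI, integral_const_mul]
  simp

/-! ### The stationary states -/

theorem IsTwoDelta.integral_eq {μ : ProbabilityMeasure Phase} {c₁ c₂ : ℝ} {φ : Phase}
    (h : IsTwoDelta μ c₁ c₂ φ) (f : Phase → ℝ) :
    ∫ θ, f θ ∂(μ : Measure Phase) = c₁ * f φ + c₂ * f (φ + (Real.pi : Phase)) := by
  obtain ⟨h12, h2, -, hμ⟩ := h
  have hI : ∀ (c : ℝ) (ψ : Phase), Integrable f (ENNReal.ofReal c • Measure.dirac ψ) :=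
    fun c ψ => (integrable_dirac (by simp)).smul_measure ENNReal.ofReal_ne_top
  rw [hμ, integral_add_measure (hI _ _) (hI _ _), integral_smul_measure, integral_smul_measure,
    integral_dirac, integral_dirac, ENNReal.toReal_ofReal (h2.trans h12.le),
    ENNReal.toReal_ofReal h2, smul_eq_mul, smul_eq_mul]

theorem exists_isTwoDelta {c₁ c₂ : ℝ} (h12 : c₂ < c₁) (h2 : 0 ≤ c₂) (hsum : c₁ + c₂ = 1)
    (φ : Phase) : ∃ μ : ProbabilityMeasure Phase, IsTwoDelta μ c₁ c₂ φ := by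
  refine ⟨⟨ENNReal.ofReal c₁ • Measure.dirac φ
      + ENNReal.ofReal c₂ • Measure.dirac (φ + ((Real.pi : ℝ) : Phase)), ⟨?_⟩⟩,
    h12, h2, hsum, rfl⟩
  simp only [Measure.coe_add, Measure.coe_smul, Pi.add_apply, Pi.smul_apply, measure_univ,
    smul_eq_mul, mul_one]
  rw [← ENNReal.ofReal_add (h2.trans h12.le) h2, hsum, ENNReal.ofReal_one]

theorem IsTwoDelta.velocity_eq {μ : ProbabilityMeasure Phase} {c₁ c₂ : ℝ} {φ : Phase}
    (h : IsTwoDelta μ c₁ c₂ φ) (θ : Phase) :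
    velocity μ θ = -(c₁ - c₂) * (θ - φ).sin := by
  rw [velocity_eq_integral, h.integral_eq, ← sub_sub, Real.Angle.sin_sub_pi]
  ring

theorem sin_two_mul_arctan (u : ℝ) : Real.sin (2 * Real.arctan u) = 2 * u / (1 + u ^ 2) := by
  have hpos : (0 : ℝ) < 1 + u ^ 2 := by positivity
  rw [Real.sin_two_mul, Real.sin_arctan, Real.cos_arctan]
  have h : √(1 + u ^ 2) * √(1 + u ^ 2) = 1 + u ^ 2 := Real.mul_self_sqrt hpos.le
  rw [mul_assoc, div_mul_div_comm, h]
  ring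

/-- The half-angle substitution `u = tan(ϑ/2)` turns `ϑ' = -R sin ϑ` into `u' = -R u`. -/
theorem hasDerivAt_two_mul_arctan (R k t : ℝ) :
    HasDerivAt (fun r => 2 * Real.arctan (Real.exp (-R * r) * k))
      (-R * Real.sin (2 * Real.arctan (Real.exp (-R * t) * k))) t := by
  have h1 : HasDerivAt (fun r : ℝ => -R * r) (-R) t := by
    simpa using (hasDerivAt_id t).const_mul (-R)
  have h2 := (((h1.exp).mul_const k).arctan).const_mul 2
  refine h2.congr_deriv ?_
  rw [sin_two_mul_arctan]
  ring

open Classical in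
/-- The flow of `ϑ' = -R sin(ϑ - φ)`. -/
noncomputable def sineFlow (R : ℝ) (φ : Phase) (t : ℝ) (θ : Phase) : Phase :=
  -- The half-angle tangent is infinite at the antipode; its default value `0` would send this fixed
  -- point to `φ`.
  if θ - φ = (Real.pi : Phase) then θ
  else φ + ((2 * Real.arctan (Real.exp (-R * t) * Real.tan ((θ - φ).toReal / 2)) : ℝ) : Phase)

theorem sineFlow_zero (R : ℝ) (φ θ : Phase) : sineFlow R φ 0 θ = θ := by
  unfold sineFlow
  split_ifs with h
  · rfl
  · have hlt : (θ - φ).toReal < Real.pi :=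
      lt_of_le_of_ne (Real.Angle.toReal_le_pi _) fun he => h (Real.Angle.toReal_eq_pi_iff.1 he)
    have hgt := Real.Angle.neg_pi_lt_toReal (θ - φ)
    rw [mul_zero, Real.exp_zero, one_mul, Real.arctan_tan (by linarith) (by linarith),
      mul_div_cancel₀ _ two_ne_zero, Real.Angle.coe_toReal]
    abel

theorem sineFlow_self (R : ℝ) (φ : Phase) (t : ℝ) : sineFlow R φ t φ = φ := by
  unfold sineFlow
  split_ifs with h
  · rfl
  · simp

theorem sineFlow_add_pi (R : ℝ) (φ : Phase) (t : ℝ) :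
    sineFlow R φ t (φ + (Real.pi : Phase)) = φ + (Real.pi : Phase) := by
  unfold sineFlow
  rw [if_pos (by abel)]

theorem IsTwoDelta.isSolution_const {μ : ProbabilityMeasure Phase} {c₁ c₂ : ℝ} {φ : Phase}
    (h : IsTwoDelta μ c₁ c₂ φ) : IsSolution fun _ => μ := by
  refine ⟨sineFlow (c₁ - c₂) φ, sineFlow_zero _ _, fun θ => ?_, fun t _ f => ?_⟩
  · by_cases hθ : θ - φ = (Real.pi : Phase)
    · refine ⟨fun _ => θ.toReal, fun t _ => ⟨?_, ?_⟩⟩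
      · simp [sineFlow, hθ]
      · rw [h.velocity_eq]
        simp [sineFlow, hθ, hasDerivWithinAt_const]
    · refine ⟨fun t => φ.toReal + 2 * Real.arctan
        (Real.exp (-(c₁ - c₂) * t) * Real.tan ((θ - φ).toReal / 2)), fun t _ => ⟨?_, ?_⟩⟩
      · simp only [sineFlow, if_neg hθ, Real.Angle.coe_add, Real.Angle.coe_toReal]
      · rw [h.velocity_eq]
        simp only [sineFlow, if_neg hθ, add_sub_cancel_left, Real.Angle.sin_coe]
        exact ((hasDerivAt_two_mul_arctan _ _ t).const_add _).hasDerivWithinAt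
  · rw [h.integral_eq, h.integral_eq, sineFlow_self, sineFlow_add_pi]

theorem exists_polar {α β : ℝ} (h : 0 < α ^ 2 + β ^ 2) :
    ∃ (R : ℝ) (φ : Phase), 0 < R ∧ R ^ 2 = α ^ 2 + β ^ 2 ∧ R * φ.cos = α ∧ R * φ.sin = β := by
  have hn : ‖(⟨α, β⟩ : ℂ)‖ ^ 2 = α ^ 2 + β ^ 2 := by
    rw [Complex.sq_norm, Complex.normSq_mk]; ring
  refine ⟨‖(⟨α, β⟩ : ℂ)‖, ((⟨α, β⟩ : ℂ).arg : Phase), ?_, hn, ?_, ?_⟩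
  · refine lt_of_le_of_ne (norm_nonneg _) fun h0 => ?_
    rw [← h0] at hn
    norm_num at hn
    linarith
  · rw [Real.Angle.cos_coe, Complex.norm_mul_cos_arg]
  · rw [Real.Angle.sin_coe, Complex.norm_mul_sin_arg]

end Kuramoto

/-! ### Proof of the theorem -/

open Kuramoto in
theorem theorem3p4 (ρ : ℝ → ProbabilityMeasure Kuramoto.Phase)
    (hρ : Kuramoto.IsSolution ρ) (hns : ¬ Kuramoto.IsStationary ρ) :
    ∃ (ρstar : ProbabilityMeasure Kuramoto.Phase) (c₁ c₂ : ℝ) (φstar : Kuramoto.Phase),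
      Kuramoto.IsTwoDelta ρstar c₁ c₂ φstar ∧
      Kuramoto.IsSolution (fun _ => ρstar) ∧
      Tendsto ρ atTop (𝓝 ρstar) ∧
      ((∀ θ : Kuramoto.Phase, (ρ 0 : Measure Kuramoto.Phase) {θ} = 0) →
        (ρstar : Measure Kuramoto.Phase) = Measure.dirac φstar) := by
  obtain ⟨Θ, h0, hchar, htrans⟩ := hρ
  set F := circleFlow h0 hchar htrans with hF
  obtain ⟨t₀, ht₀, hq⟩ : ∃ t₀, 0 < t₀ ∧ 0 < F.q t₀ := by
    by_contra! hcon
    exact hns (isStationary_of_q_eq_zero h0 hchar htrans fun t ht =>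
      le_antisymm (hcon t ht) (F.q_nonneg t))
  obtain ⟨α, β, hα, hβ⟩ := F.exists_tendsto_mean ht₀ hq
  have hqlim : Tendsto F.q atTop (𝓝 (α ^ 2 + β ^ 2)) := (hα.pow 2).add (hβ.pow 2)
  have hLpos : 0 < α ^ 2 + β ^ 2 := hq.trans_le (ge_of_tendsto hqlim (by
    filter_upwards [eventually_ge_atTop t₀] with t ht using F.q_le_q ht₀ ht))
  have hL1 : α ^ 2 + β ^ 2 ≤ 1 := le_of_tendsto' hqlim F.q_le_one
  obtain ⟨R, φ, hR, hRsq, hRc, hRs⟩ := exists_polar hLpos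
  have hR1 : R ≤ 1 := by nlinarith
  have hα' : Tendsto (fun t => meanCos (ρ t)) atTop (𝓝 α) := hα.congr' (by
    filter_upwards [eventually_ge_atTop 0] with t ht using circleFlow_a h0 hchar htrans ht)
  have hβ' : Tendsto (fun t => meanSin (ρ t)) atTop (𝓝 β) := hβ.congr' (by
    filter_upwards [eventually_ge_atTop 0] with t ht using circleFlow_b h0 hchar htrans ht)
  have hcos : Tendsto (fun t => ∫ θ : Phase, (θ - φ).cos ∂(ρ t : Measure Phase)) atTop (𝓝 R) := by
    have h := (hα'.mul_const φ.cos).add (hβ'.mul_const φ.sin)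
    have e : α * φ.cos + β * φ.sin = R := by
      rw [← hRc, ← hRs]
      linear_combination R * Real.Angle.cos_sq_add_sin_sq φ
    rw [e] at h
    refine h.congr fun t => ?_
    simp_rw [cos_sub_angle]
    rw [integral_add ((integrable_cos _).mul_const _) ((integrable_sin _).mul_const _),
      integral_mul_const, integral_mul_const, meanCos, meanSin]
  have hsin : Tendsto (fun t => ∫ θ : Phase, (θ - φ).sin ^ 2 ∂(ρ t : Measure Phase)) atTop
      (𝓝 0) := by
    -- `P` measures concentration about the current mean phase. Replacing that mean by its limit
    -- costs, by `(x + y)² ≤ 2x² + 2y²` and Cauchy–Schwarz, at most a multiple of their squared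
    -- distance; the constant `4` is not sharp.
    have hlim : Tendsto (fun t => (R ^ 2)⁻¹ * (2 * F.P t
        + 4 * ((α - meanCos (ρ t)) ^ 2 + (β - meanSin (ρ t)) ^ 2))) atTop (𝓝 0) := by
      simpa using (((F.tendsto_P ht₀ hq).const_mul 2).add
        ((((hα'.const_sub α).pow 2).add ((hβ'.const_sub β).pow 2)).const_mul 4)).const_mul
          (R ^ 2)⁻¹
    refine squeeze_zero' (Eventually.of_forall fun t => integral_nonneg fun _ => sq_nonneg _) ?_ hlim
    filter_upwards [eventually_ge_atTop 0] with t ht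
    rw [hF, circleFlow_P h0 hchar htrans ht]
    set A := meanCos (ρ t)
    set B := meanSin (ρ t)
    have hcs := Real.Angle.continuous_sin
    have hcc := Real.Angle.continuous_cos
    have hI : Integrable (fun θ : Phase => 2 * (A * θ.sin - B * θ.cos) ^ 2)
        (ρ t : Measure Phase) := integrable_of_continuous _ (by fun_prop)
    have hI' : Integrable (fun θ : Phase => 2 * (A * θ.sin - B * θ.cos) ^ 2
        + 4 * ((α - A) ^ 2 + (β - B) ^ 2)) (ρ t : Measure Phase) := hI.add (integrable_const _)
    have hle : ∫ θ : Phase, (θ - φ).sin ^ 2 ∂(ρ t : Measure Phase) ≤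
        ∫ θ : Phase, (R ^ 2)⁻¹ * (2 * (A * θ.sin - B * θ.cos) ^ 2
          + 4 * ((α - A) ^ 2 + (β - B) ^ 2)) ∂(ρ t : Measure Phase) := by
      refine integral_mono (integrable_of_continuous _ ((continuous_sin_sub φ).pow 2))
        (hI'.const_mul _) fun θ => ?_
      simp only
      rw [← div_eq_inv_mul, le_div_iff₀ (by positivity)]
      have e : (θ - φ).sin ^ 2 * R ^ 2 =
          ((A * θ.sin - B * θ.cos) + ((α - A) * θ.sin - (β - B) * θ.cos)) ^ 2 := by
        rw [sin_sub_angle, ← hRc, ← hRs]; ring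
      have hcs : ((α - A) * θ.sin - (β - B) * θ.cos) ^ 2 ≤ (α - A) ^ 2 + (β - B) ^ 2 := by
        have := Real.Angle.cos_sq_add_sin_sq θ
        have e2 : (α - A) ^ 2 + (β - B) ^ 2 = ((α - A) * θ.sin - (β - B) * θ.cos) ^ 2
            + ((α - A) * θ.cos + (β - B) * θ.sin) ^ 2 := by
          linear_combination -((α - A) ^ 2 + (β - B) ^ 2) * this
        linarith [sq_nonneg ((α - A) * θ.cos + (β - B) * θ.sin)]
      rw [e]
      nlinarith [sq_nonneg ((A * θ.sin - B * θ.cos) - ((α - A) * θ.sin - (β - B) * θ.cos))]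
    refine hle.trans (le_of_eq ?_)
    rw [integral_const_mul, integral_add hI (integrable_const _), integral_const_mul]
    simp
  -- The masses solve `c₁ + c₂ = 1` and `c₁ - c₂ = R`; strictness comes from `R > 0`.
  obtain ⟨μ, hμ⟩ := exists_isTwoDelta (c₁ := (1 + R) / 2) (c₂ := (1 - R) / 2) (by linarith)
    (by linarith) (by ring) φ
  refine ⟨μ, _, _, φ, hμ, hμ.isSolution_const, ?_, fun hatom => ?_⟩
  · rw [ProbabilityMeasure.tendsto_iff_forall_integral_tendsto]
    intro f
    rw [hμ.integral_eq]
    exact tendsto_integral_of_tendsto_sin_sq hsin hcos f.continuous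
  · have hinj : ∀ t, 0 < t → ∀ θ ψ, F.X t θ = F.X t ψ → F.Y t θ = F.Y t ψ → θ = ψ := by
      intro t ht θ ψ hX hY
      have h := ((hchar θ).chordSq_le (hchar ψ) ht.le).2
      have hX' : (Θ (max t 0) θ).cos = (Θ (max t 0) ψ).cos := hX
      have hY' : (Θ (max t 0) θ).sin = (Θ (max t 0) ψ).sin := hY
      rw [max_eq_left ht.le] at hX' hY'
      simp only [h0] at h
      have hz : chordSq (Θ t θ) (Θ t ψ) = 0 := by simp [chordSq, hX', hY']
      rw [hz] at h
      exact eq_of_chordSq_nonpos (nonpos_of_mul_nonpos_left h (Real.exp_pos _))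
    have hL := F.limit_q_eq_one ht₀ hq hinj hatom hqlim
    have hR' : R = 1 := by nlinarith
    have hm := hμ.2.2.2
    rw [hm, hR']
    simp
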